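/- **Setting.** A photon variable is $k=(\mathbf k,\lambda)\in\mathbb R^3\times\{1,2\}$, $|k|:=|\mathbf k|$, $\int dk:=\sum_\lambda\int d^3\mathbf k$, and $B:=\{k:|k|\le 1\}$. Let $\mathcal F$ be the bosonic Fock space over $L^2(\mathbb R^3\times\{1,2\})$, with creation and annihilation operators $a^*(k),a(k)$ and field energy $H_f=\int |k|\,a^*(k)a(k)\,dk$, and let $\mathcal H_{red}:=P_{red}\mathcal F$, $P_{red}:=P_{[0,1]}(H_f)$. Fix $\mu>0$ and $\xi\in(0,1)$. Let $\mathcal W_{0,0}:=C^1([0,1])$ with $\|w\|:=\|w\|_\infty+\|w'\|_\infty$, and, for $m+n\ge1$, let $\mathcal W_{m,n}$ be the space of measurable $w_{m,n}:B^m\times B^n\to\mathcal W_{0,0}$, symmetric in the $m$ arguments from $B^m$ and in the $n$ arguments from $B^n$, with $\|w_{m,n}\|_\mu^2:=\int\|w_{m,n}(K)\|^2\,|K|^{-2-2\mu}dK<\infty$, where $|K|$ is the product of the $m+n$ numbers $|k_j|$. Let $\mathcal W_\xi$ be the space of sequences $w=(w_{m,n})_{m,n\ge0}$ with $\|w\|_{\mu,\xi}:=\sum_{m,n}\xi^{-(m+n)}\|w_{m,n}\|_\mu<\infty$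 (where $\|w_{0,0}\|_\mu:=\|w_{0,0}\|$). For $w\in\mathcal W_\xi$ put $H_{0,0}(w):=w_{0,0}(H_f)$, $$H_{m,n}(w):=P_{red}\Big(\int_{B^{m}\times B^n}a^*(k_1)\cdots a^*(k_m)\,w_{m,n}(H_f,K)\,a(\tilde k_1)\cdots a(\tilde k_n)\,dK\Big)P_{red}\quad(m+n\ge 1),$$ and $H(w):=\sum_{m,n}H_{m,n}(w)$, a norm convergent sum in $\mathcal L(\mathcal H_{red})$. For $\alpha\in[0,\infty]$ and $\beta,\gamma\geq 0$ let $$\mathcal B(\alpha,\beta,\gamma):=\{H(w): w\in\mathcal W_\xi,\ |w_{0,0}(0)|\le\alpha,\ \|w_{0,0}'-1\|_\infty\le\beta,\ \|w-w_{0,0}\|_{\mu,\xi}\le\gamma\}.$$ Let $\chi,\bar\chi\in C^\infty(\mathbb R;[0,1])$ with $\chi(t)=1$ for $t\le 3/4$, $\chi(t)=0$ for $t\ge1$ and $\chi^2+\bar\chi^2=1$. For $\rho>0$ put $\chi_\rho:=\chi(H_f/\rho)$ and $\bar\chi_\rho:=\bar\chi(H_f/\rho)$. For $H,T\in\mathcal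 L(\mathcal H_{red})$ let $W:=H-T$ and $H_{\bar\chi_\rho}:=T+\bar\chi_\rho W\bar\chi_\rho$. The pair $(H,T)$ is a Feshbach pair for $\chi_\rho$ if $T$ commutes with $\chi_\rho$ and $\bar\chi_\rho$, and $T$ and $H_{\bar\chi_\rho}$ map $\operatorname{Ran}\bar\chi_\rho$ bijectively to itself with bounded inverse. In that case $$F_{\chi_\rho}(H,T):=T+\chi_\rho W\chi_\rho-\chi_\rho W\bar\chi_\rho H_{\bar\chi_\rho}^{-1}\bar\chi_\rho W\chi_\rho ,$$ and, if $\rho<1$ and $T=H_{0,0}(w)$ is the diagonal part of $H=H(w)$, $\mathcal R_\rho(H):=\rho^{-1}\Gamma_\rho F_{\chi_\rho}(H,T)\Gamma_\rho^*$, where $\Gamma_\rho:\operatorname{Ran}P_{[0,\rho]}(H_f)\to\mathcal H_{red}$ is the unitary map that is the restriction of the second quantization of $(U_\rho f)(k)=\rho^{3/2}f(\rho k)$. A function of several complex variables is called analytic if it is analytic in each variable separately; operator-valued functions are analytic with respect to the operator norm. **Proposition.** Let $S\subset\mathbb C^{\nu+1}$ be open, $\nu\ge0$, and let $w^\sigma\in\mathcal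 W_\xi$ for $\sigma\in S$. Suppose that $\sigma\mapsto H(w^\sigma)\in\mathcal L(\mathcal H_{red})$ is analytic on $S$ and that, for some $\alpha,\beta,\gamma$, $H(w^\sigma)\in\mathcal B(\alpha,\beta,\gamma)$ for all $\sigma\in S$. Then: (a) $\sigma\mapsto H_{0,0}(w^\sigma)=w^\sigma_{0,0}(H_f)$ is analytic on $S$. (b) Let $\rho>0$. If $(H(w^\sigma),H_{0,0}(w^\sigma))$ is a Feshbach pair for $\chi_\rho$ for all $\sigma\in S$, then $\sigma\mapsto F_{\chi_\rho}(H(w^\sigma),H_{0,0}(w^\sigma))$ is analytic on $S$. Consequently, if moreover $\rho<1$, then $\sigma\mapsto\mathcal R_\rho(H(w^\sigma))$ is analytic on $S$. -/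

import Mathlib

open MeasureTheory Filter Topology
open scoped ENNReal NNReal InnerProductSpace ComplexConjugate ContDiff

noncomputable section

namespace Renorm

/-- A photon variable `k = (𝐤, λ)`: momentum `𝐤 ∈ ℝ³` and polarization `λ ∈ {1, 2}`. -/
abbrev Photon : Type := EuclideanSpace ℝ (Fin 3) × Fin 2

/-- `|k| = |𝐤|`. -/
def Photon.abs (k : Photon) : ℝ := ‖k.1‖

/-- `∫ dk = ∑_λ ∫ d³𝐤`. -/
def dk : Measure Photon := (volume : Measure (EuclideanSpace ℝ (Fin 3))).prod Measure.count

/-- `dk` restricted to the unit ball `B = {k : |k| ≤ 1}`. -/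
def dkB : Measure Photon := dk.restrict {k | k.abs ≤ 1}

instance : SigmaFinite dk := by unfold dk; infer_instance
instance : SigmaFinite dkB := by unfold dkB; infer_instance

/-- Configurations of finitely many photons: the disjoint union over `n` of the `n`-photon
configurations `(ℝ³ × {1, 2})ⁿ`. -/
abbrev Conf : Type := Σ n : ℕ, (Fin n → Photon)

/-- The inclusion of the `n`-photon sector. -/
def sector (n : ℕ) (K : Fin n → Photon) : Conf := ⟨n, K⟩

/-- The measure `dk₁ ⋯ dkₙ` on each `n`-photon sector (the unit point mass for `n = 0`). -/
def dConf : Measure Conf :=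
  Measure.sum fun n : ℕ => (Measure.pi fun _ : Fin n => dk).map (sector n)

/-- The energy `∑ⱼ |kⱼ|` of a configuration. -/
def energy (x : Conf) : ℝ := ∑ i, (x.2 i).abs

lemma measurableEmbedding_mk (n : ℕ) :
    MeasurableEmbedding (sector n) where
  injective := fun _ _ h => sigma_mk_injective h
  measurable := fun s hs => by
    have h : MeasurableSet[⨅ a : ℕ, MeasurableSpace.map (Sigma.mk a) _] s := hs
    rw [MeasurableSpace.measurableSet_iInf] at h
    exact h n
  measurableSet_image' := fun s hs => by
    change MeasurableSet[⨅ a : ℕ, MeasurableSpace.map (Sigma.mk a) _] _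
    rw [MeasurableSpace.measurableSet_iInf]
    intro a
    change MeasurableSet (sector a ⁻¹' (sector n '' s))
    rcases eq_or_ne a n with rfl | hne
    · have hinj : Function.Injective (sector a) := fun _ _ h => sigma_mk_injective h
      rwa [Set.preimage_image_eq _ hinj]
    · convert MeasurableSet.empty
      ext y
      simp only [Set.mem_preimage, Set.mem_image, Set.mem_empty_iff_false, iff_false]
      rintro ⟨z, _, hz⟩
      exact hne (congrArg Sigma.fst hz).symm

lemma measurable_conf {β : Type*} [MeasurableSpace β] {f : Conf → β}
    (h : ∀ n, Measurable fun K : Fin n → Photon => f ⟨n, K⟩) : Measurable f := by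
  intro s hs
  change MeasurableSet[⨅ a : ℕ, MeasurableSpace.map (Sigma.mk a) _] _
  rw [MeasurableSpace.measurableSet_iInf]
  exact fun a => h a hs

lemma measurable_prod_conf {A β : Type*} [MeasurableSpace A] [MeasurableSpace β]
    {f : A × Conf → β} (h : ∀ n, Measurable fun p : A × (Fin n → Photon) => f (p.1, ⟨n, p.2⟩)) :
    Measurable f := by
  intro s hs
  have : f ⁻¹' s = ⋃ n, (Prod.map id (sector n) : A × (Fin n → Photon) → A × Conf) ''
      ((fun p : A × (Fin n → Photon) => f (p.1, ⟨n, p.2⟩)) ⁻¹' s) := by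
    ext ⟨a, n, K⟩
    simp only [Set.mem_preimage, Set.mem_iUnion, Set.mem_image, Prod.exists, Prod.map_apply, id]
    constructor
    · exact fun hx => ⟨n, a, K, hx, rfl⟩
    · rintro ⟨m, b, L, hx, he⟩
      rw [← he]; exact hx
  rw [this]
  exact MeasurableSet.iUnion fun n =>
    (MeasurableEmbedding.id.prodMap (measurableEmbedding_mk n)).measurableSet_image.2 (h n hs)

lemma ae_dConf {p : Conf → Prop} :
    (∀ᵐ x ∂dConf, p x) ↔ ∀ n, ∀ᵐ K ∂(Measure.pi fun _ : Fin n => dk), p ⟨n, K⟩ := by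
  rw [dConf, Measure.ae_sum_iff]
  exact forall_congr' fun n => (measurableEmbedding_mk n).ae_map_iff

lemma lintegral_dConf (f : Conf → ℝ≥0∞) :
    ∫⁻ x, f x ∂dConf = ∑' n, ∫⁻ K, f ⟨n, K⟩ ∂(Measure.pi fun _ : Fin n => dk) := by
  rw [dConf, lintegral_sum_measure]
  exact tsum_congr fun n => (measurableEmbedding_mk n).lintegral_map _

instance : SFinite dConf := by unfold dConf; infer_instance

lemma measurable_abs : Measurable Photon.abs := measurable_fst.norm

lemma measurable_energy : Measurable energy :=
  measurable_conf fun _ => Finset.measurable_fun_sum Finset.univ fun i _ =>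
    measurable_abs.comp (measurable_pi_apply i)

lemma energy_nonneg (x : Conf) : 0 ≤ energy x := Finset.sum_nonneg fun _ _ => norm_nonneg _

lemma measurePreserving_perm {n : ℕ} (π : Equiv.Perm (Fin n)) :
    MeasurePreserving (fun K : Fin n → Photon => K ∘ π)
      (Measure.pi fun _ : Fin n => dk) (Measure.pi fun _ : Fin n => dk) := by
  have := measurePreserving_piCongrLeft (fun _ : Fin n => dk) π.symm
  convert this using 1
  funext K i
  have := Equiv.piCongrLeft_apply_apply (fun _ : Fin n => Photon) π.symm K (π i)
  rw [Equiv.symm_apply_apply] at this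
  exact this.symm

/-- Bosonic Fock space over `L²(ℝ³ × {1, 2})`: square integrable families `(ψₙ)ₙ` of functions
`ψₙ` of `n` photon variables that are invariant under permutations of these variables. -/
def fock : Submodule ℂ (Lp ℂ 2 dConf) where
  carrier := {ψ | ∀ (n : ℕ) (π : Equiv.Perm (Fin n)),
    ∀ᵐ K ∂(Measure.pi fun _ : Fin n => dk), ψ ⟨n, K ∘ π⟩ = ψ ⟨n, K⟩}
  add_mem' := fun {φ ψ} hφ hψ n π => by
    have h := ae_dConf.1 (Lp.coeFn_add φ ψ) n
    filter_upwards [hφ n π, hψ n π, h, (measurePreserving_perm π).quasiMeasurePreserving.ae h]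
      with K h1 h2 h3 h4
    rw [h3, h4, Pi.add_apply, Pi.add_apply, h1, h2]
  zero_mem' := fun n π => by
    have h := ae_dConf.1 (Lp.coeFn_zero ℂ 2 dConf) n
    filter_upwards [h, (measurePreserving_perm π).quasiMeasurePreserving.ae h] with K h3 h4
    rw [h3, h4]; rfl
  smul_mem' := fun c ψ hψ n π => by
    have h := ae_dConf.1 (Lp.coeFn_smul c ψ) n
    filter_upwards [hψ n π, h, (measurePreserving_perm π).quasiMeasurePreserving.ae h]
      with K h2 h3 h4
    rw [h3, h4, Pi.smul_apply, Pi.smul_apply, h2]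

/-- The spectral subspace `H_f ≤ 1` in `L²` of configuration space: `H_f` is multiplication by the
energy. -/
def lowEnergy : Submodule ℂ (Lp ℂ 2 dConf) where
  carrier := {ψ | ∀ᵐ x ∂dConf, 1 < energy x → ψ x = 0}
  add_mem' := fun {φ ψ} hφ hψ => by
    change ∀ᵐ x ∂dConf, _
    filter_upwards [hφ, hψ, Lp.coeFn_add φ ψ] with x h1 h2 h3 hx
    rw [h3, Pi.add_apply, h1 hx, h2 hx, add_zero]
  zero_mem' := by
    change ∀ᵐ x ∂dConf, _
    filter_upwards [Lp.coeFn_zero ℂ 2 dConf] with x h3 _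
    rw [h3]; rfl
  smul_mem' := fun c ψ hψ => by
    change ∀ᵐ x ∂dConf, _
    filter_upwards [hψ, Lp.coeFn_smul c ψ] with x h2 h3 hx
    rw [h3, Pi.smul_apply, h2 hx, smul_zero]

/-- The reduced space `H_red = P_{[0,1]}(H_f) F`. -/
def HredSpace : Submodule ℂ (Lp ℂ 2 dConf) := fock ⊓ lowEnergy

lemma isClosed_HredSpace : IsClosed (HredSpace : Set (Lp ℂ 2 dConf)) := by
  refine IsSeqClosed.isClosed fun u ψ hu hψ => ?_
  obtain ⟨ns, _, hns⟩ := (tendstoInMeasure_of_tendsto_Lp hψ).exists_seq_tendsto_ae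
  refine ⟨fun n π => ?_, ?_⟩
  · have h := ae_dConf.1 hns n
    have h' : ∀ᵐ K ∂(Measure.pi fun _ : Fin n => dk), ∀ j, u (ns j) ⟨n, K ∘ π⟩ = u (ns j) ⟨n, K⟩ :=
      ae_all_iff.2 fun j => (hu (ns j)).1 n π
    filter_upwards [h, (measurePreserving_perm π).quasiMeasurePreserving.ae h, h'] with K h1 h2 h3
    exact tendsto_nhds_unique h2 (h1.congr fun j => (h3 j).symm)
  · have h' : ∀ᵐ x ∂dConf, ∀ j, 1 < energy x → u (ns j) x = 0 :=
      ae_all_iff.2 fun j => (hu (ns j)).2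
    change ∀ᵐ x ∂dConf, _
    filter_upwards [hns, h'] with x h1 h3 hx
    exact tendsto_nhds_unique h1 (tendsto_const_nhds.congr fun j => (h3 j hx).symm)

/-- The Hilbert space `H_red` as a type. -/
def Hred : Type := HredSpace

instance : NormedAddCommGroup Hred := inferInstanceAs (NormedAddCommGroup HredSpace)
instance : InnerProductSpace ℂ Hred := inferInstanceAs (InnerProductSpace ℂ HredSpace)
instance : CompleteSpace Hred := isClosed_HredSpace.completeSpace_coe

namespace Hred

/-- The inclusion of `H_red` in `L²` of configuration space. -/
def toLp (ψ : Hred) : Lp ℂ 2 dConf := Subtype.val (p := (· ∈ HredSpace)) ψ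

/-- Elements of `L²` of configuration space that lie in `H_red`. -/
def mk (ψ : Lp ℂ 2 dConf) (h : ψ ∈ HredSpace) : Hred := (⟨ψ, h⟩ : HredSpace)

lemma toLp_mk (ψ : Lp ℂ 2 dConf) (h : ψ ∈ HredSpace) : (mk ψ h).toLp = ψ := rfl

lemma toLp_mem (ψ : Hred) : ψ.toLp ∈ HredSpace := Subtype.prop (p := (· ∈ HredSpace)) ψ

lemma toLp_injective : Function.Injective toLp := Subtype.val_injective

lemma toLp_add (φ ψ : Hred) : (φ + ψ).toLp = φ.toLp + ψ.toLp := rfl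

lemma toLp_smul (c : ℂ) (ψ : Hred) : (c • ψ).toLp = c • ψ.toLp := rfl

lemma norm_toLp (ψ : Hred) : ‖ψ.toLp‖ = ‖ψ‖ := rfl

lemma inner_toLp (φ ψ : Hred) : ⟪φ.toLp, ψ.toLp⟫_ℂ = ⟪φ, ψ⟫_ℂ := rfl

end Hred

/-- The interval `[0, 1]`. -/
abbrev I01 : Type := Set.Icc (0 : ℝ) 1

/-- The energy as an element of `[0, 1]`; energies above `1` do not matter on `H_red`. -/
def energy01 (x : Conf) : I01 := Set.projIcc 0 1 zero_le_one (energy x)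

lemma measurable_energy01 : Measurable energy01 :=
  continuous_projIcc.measurable.comp measurable_energy

lemma memLp_mul (f : C(I01, ℂ)) (ψ : Lp ℂ 2 dConf) :
    MemLp (fun x => f (energy01 x) * ψ x) 2 dConf :=
  MemLp.of_le_mul (c := ‖f‖) (Lp.memLp ψ)
    (((f.continuous.measurable.comp measurable_energy01).aestronglyMeasurable).mul
      (Lp.aestronglyMeasurable ψ))
    (ae_of_all _ fun x => by
      rw [norm_mul]; exact mul_le_mul_of_nonneg_right (f.norm_coe_le_norm _) (norm_nonneg _))

lemma energy01_perm {n : ℕ} (π : Equiv.Perm (Fin n)) (K : Fin n → Photon) :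
    energy01 ⟨n, K ∘ π⟩ = energy01 ⟨n, K⟩ := by
  unfold energy01 energy
  congr 1
  exact Equiv.sum_comp π fun i => (K i).abs

lemma mul_mem (f : C(I01, ℂ)) (ψ : Hred) : (memLp_mul f ψ.toLp).toLp ∈ HredSpace := by
  refine ⟨fun n π => ?_, ?_⟩
  · have h := ae_dConf.1 (memLp_mul f ψ.toLp).coeFn_toLp n
    filter_upwards [h, (measurePreserving_perm π).quasiMeasurePreserving.ae h, ψ.toLp_mem.1 n π]
      with K h1 h2 h3
    rw [h1, h2, h3, energy01_perm]
  · change ∀ᵐ x ∂dConf, _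
    filter_upwards [(memLp_mul f ψ.toLp).coeFn_toLp, ψ.toLp_mem.2] with x h1 h2 hx
    rw [h1, h2 hx, mul_zero]

/-- Functional calculus of `H_f` on `H_red`: for continuous `f` on `[0, 1]`, the operator `f(H_f)`
multiplies by `f` of the energy. -/
def fnHf (f : C(I01, ℂ)) : Hred →L[ℂ] Hred :=
  LinearMap.mkContinuous
    { toFun := fun ψ => Hred.mk (memLp_mul f ψ.toLp).toLp (mul_mem f ψ)
      map_add' := fun φ ψ => Hred.toLp_injective <| Lp.ext <| by
        change _ =ᵐ[dConf] ↑↑((memLp_mul f φ.toLp).toLp + (memLp_mul f ψ.toLp).toLp)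
        filter_upwards [(memLp_mul f (φ + ψ).toLp).coeFn_toLp, (memLp_mul f φ.toLp).coeFn_toLp,
          (memLp_mul f ψ.toLp).coeFn_toLp,
          Lp.coeFn_add (memLp_mul f φ.toLp).toLp (memLp_mul f ψ.toLp).toLp,
          Lp.coeFn_add φ.toLp ψ.toLp] with x h1 h2 h3 h4 h5
        rw [Hred.toLp_mk, h1, h4, Pi.add_apply, h2, h3, Hred.toLp_add, h5, Pi.add_apply, mul_add]
      map_smul' := fun c ψ => Hred.toLp_injective <| Lp.ext <| by
        change _ =ᵐ[dConf] ↑↑(c • (memLp_mul f ψ.toLp).toLp)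
        filter_upwards [(memLp_mul f (c • ψ).toLp).coeFn_toLp, (memLp_mul f ψ.toLp).coeFn_toLp,
          Lp.coeFn_smul c (memLp_mul f ψ.toLp).toLp, Lp.coeFn_smul c ψ.toLp] with x h1 h2 h3 h4
        rw [Hred.toLp_mk, h1, h3, Pi.smul_apply, h2, Hred.toLp_smul, h4, Pi.smul_apply, smul_eq_mul,
          smul_eq_mul, mul_left_comm] }
    ‖f‖ fun ψ => by
      refine Lp.norm_le_mul_norm_of_ae_le_mul (f := (memLp_mul f ψ.toLp).toLp) (g := ψ.toLp) ?_
      filter_upwards [(memLp_mul f ψ.toLp).coeFn_toLp] with x h1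
      rw [h1, norm_mul]
      exact mul_le_mul_of_nonneg_right (f.norm_coe_le_norm _) (norm_nonneg _)

lemma fnHf_coe (f : C(I01, ℂ)) (ψ : Hred) :
    ∀ᵐ x ∂dConf, (fnHf f ψ).toLp x = f (energy01 x) * ψ.toLp x :=
  (memLp_mul f ψ.toLp).coeFn_toLp


/-- `W₀,₀ = C¹([0, 1])`: pairs `(w, w')` of continuous functions on `[0, 1]` such that `w'` is the
derivative of `w` (one-sided at the end points), with the norm `‖w‖_∞ + ‖w'‖_∞`. -/
def C1Space : Submodule ℂ (WithLp 1 (C(I01, ℂ) × C(I01, ℂ))) where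
  carrier := {w | ∀ r : I01, HasDerivWithinAt (fun t => w.fst (Set.projIcc 0 1 zero_le_one t))
    (w.snd r) (Set.Icc 0 1) r}
  add_mem' := fun hv hw r => (hv r).add (hw r)
  zero_mem' := fun r => hasDerivWithinAt_const (r : ℝ) _ (0 : ℂ)
  smul_mem' := fun c _ hw r => (hw r).const_smul c

/-- The type of elements of `C¹([0, 1])`. -/
def C1 : Type := C1Space

instance : NormedAddCommGroup C1 := inferInstanceAs (NormedAddCommGroup C1Space)
instance : NormedSpace ℂ C1 := inferInstanceAs (NormedSpace ℂ C1Space)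

/-- The function underlying an element of `C¹([0, 1])`. -/
def C1.fn (w : C1) : C(I01, ℂ) :=
  (Subtype.val (p := (· ∈ C1Space)) w).fst

/-- The derivative of an element of `C¹([0, 1])`. -/
def C1.deriv (w : C1) : C(I01, ℂ) :=
  (Subtype.val (p := (· ∈ C1Space)) w).snd

lemma C1.norm_fn_apply_le (w : C1) (r : I01) : ‖w.fn r‖ ≤ ‖w‖ :=
  (w.fn.norm_coe_le_norm r).trans (WithLp.norm_fst_le _ (Subtype.val (p := (· ∈ C1Space)) w))

/-- The measure `dK / |K|^{2 + 2μ}` on `B^m × B^n`, where `|K| = ∏ |kⱼ|` and `∅`-products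
are `1`. -/
def kernelMeasure (μ : ℝ≥0) (m n : ℕ) : Measure ((Fin m → Photon) × (Fin n → Photon)) :=
  ((Measure.pi fun _ : Fin m => dkB).prod (Measure.pi fun _ : Fin n => dkB)).withDensity
    fun K => (ENNReal.ofReal (((∏ i, (K.1 i).abs) * ∏ j, (K.2 j).abs) ^ (2 + 2 * (μ : ℝ))))⁻¹

/-- `W_{m,n} = L²_s(B^{m+n}, dK / |K|^{2+2μ}; C¹([0, 1]))`: the square integrable kernels that are
symmetric in the first `m` and in the last `n` photon variables. -/
structure Kernel (μ : ℝ≥0) (m n : ℕ) where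
  /-- The underlying class of square integrable functions. -/
  toLp : Lp C1 2 (kernelMeasure μ m n)
  symm : ∀ (π : Equiv.Perm (Fin m)) (τ : Equiv.Perm (Fin n)),
    ∀ᵐ K ∂(kernelMeasure μ m n), toLp (K.1 ∘ π, K.2 ∘ τ) = toLp K

/-- Annihilation of the photons `k = (k₁, …, k_m)`:
`(a(k₁) ⋯ a(k_m) ψ)_N (x) = ((N + m)! / N!)^{1/2} ψ_{m + N}(k, x)`. -/
def annihilate {m : ℕ} (ψ : Conf → ℂ) (k : Fin m → Photon) (x : Conf) : ℂ :=
  (Real.sqrt ((m + x.1).descFactorial m) : ℂ) * ψ ⟨m + x.1, Fin.append k x.2⟩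

/-- The integrand of the sesquilinear form of `∫ a^*(k) w(H_f, k, k̃) a(k̃) dk dk̃`. -/
def formIntegrand {m n : ℕ} (w : (Fin m → Photon) × (Fin n → Photon) → C1) (φ ψ : Conf → ℂ)
    (z : (Fin m → Photon) × (Fin n → Photon) × Conf) : ℂ :=
  conj (annihilate φ z.1 z.2.2) * (w (z.1, z.2.1)).fn (energy01 z.2.2) * annihilate ψ z.2.1 z.2.2

/-- The measure `dk dk̃ dx` with `k ∈ B^m`, `k̃ ∈ B^n`. -/
def formMeasure (m n : ℕ) : Measure ((Fin m → Photon) × (Fin n → Photon) × Conf) :=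
  (Measure.pi fun _ : Fin m => dkB).prod ((Measure.pi fun _ : Fin n => dkB).prod dConf)

lemma C1.continuous_fn : Continuous C1.fn :=
  (WithLp.continuous_fst 1 _ _).comp continuous_subtype_val

lemma pi_dkB_le (m : ℕ) : (Measure.pi fun _ : Fin m => dkB) ≤ Measure.pi fun _ : Fin m => dk := by
  have h := Measure.restrict_pi_pi (fun _ : Fin m => dk) (fun _ => {k : Photon | k.abs ≤ 1})
  unfold dkB
  rw [← h]
  exact Measure.restrict_le_self

lemma measurePreserving_append (m N : ℕ) :
    MeasurePreserving (fun p : (Fin m → Photon) × (Fin N → Photon) => Fin.append p.1 p.2)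
      ((Measure.pi fun _ : Fin m => dk).prod (Measure.pi fun _ : Fin N => dk))
      (Measure.pi fun _ : Fin (m + N) => dk) := by
  have h1 := measurePreserving_sumPiEquivProdPi_symm (fun _ : Fin m ⊕ Fin N => dk)
  have h2 := measurePreserving_piCongrLeft (fun _ : Fin (m + N) => dk) finSumFinEquiv
  convert h2.comp h1 using 1
  funext p i
  refine Fin.addCases (fun j => ?_) (fun j => ?_) i
  · have := Equiv.piCongrLeft_apply_apply (fun _ : Fin (m + N) => Photon) finSumFinEquiv
      ((MeasurableEquiv.sumPiEquivProdPi fun _ : Fin m ⊕ Fin N => Photon).symm p) (Sum.inl j)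
    rw [finSumFinEquiv_apply_left] at this
    rw [Fin.append_left, Function.comp, MeasurableEquiv.coe_piCongrLeft, this]
    rfl
  · have := Equiv.piCongrLeft_apply_apply (fun _ : Fin (m + N) => Photon) finSumFinEquiv
      ((MeasurableEquiv.sumPiEquivProdPi fun _ : Fin m ⊕ Fin N => Photon).symm p) (Sum.inr j)
    rw [finSumFinEquiv_apply_right] at this
    rw [Fin.append_right, Function.comp, MeasurableEquiv.coe_piCongrLeft, this]
    rfl

lemma measurable_append_conf (m : ℕ) :
    Measurable fun p : (Fin m → Photon) × Conf => (⟨m + p.2.1, Fin.append p.1 p.2.2⟩ : Conf) :=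
  measurable_prod_conf fun N =>
    (measurableEmbedding_mk (m + N)).measurable.comp (measurePreserving_append m N).measurable

lemma lintegral_append_le (m N : ℕ) {f : (Fin (m + N) → Photon) → ℝ≥0∞} (hf : Measurable f) :
    ∫⁻ x, ∫⁻ k, f (Fin.append k x) ∂(Measure.pi fun _ : Fin m => dkB)
        ∂(Measure.pi fun _ : Fin N => dk) ≤ ∫⁻ y, f y ∂(Measure.pi fun _ : Fin (m + N) => dk) := by
  have hm := (measurePreserving_append m N).measurable
  rw [← (measurePreserving_append m N).lintegral_comp hf, lintegral_prod_symm'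
    (fun p : (Fin m → Photon) × (Fin N → Photon) => f (Fin.append p.1 p.2)) (hf.comp hm)]
  exact lintegral_mono fun x => lintegral_mono' (pi_dkB_le m) le_rfl

lemma lintegral_prod_dConf (m : ℕ) {G : (Fin m → Photon) × Conf → ℝ≥0∞} (hG : Measurable G) :
    ∫⁻ z, G z ∂((Measure.pi fun _ : Fin m => dkB).prod dConf) =
      ∑' N : ℕ, ∫⁻ x : Fin N → Photon, ∫⁻ k, G (k, ⟨N, x⟩) ∂(Measure.pi fun _ : Fin m => dkB)
        ∂(Measure.pi fun _ : Fin N => dk) := by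
  rw [lintegral_prod_symm' _ hG, lintegral_dConf]

lemma quasiMeasurePreserving_append (m : ℕ) :
    Measure.QuasiMeasurePreserving
      (fun p : (Fin m → Photon) × Conf => (⟨m + p.2.1, Fin.append p.1 p.2.2⟩ : Conf))
      ((Measure.pi fun _ : Fin m => dkB).prod dConf) dConf := by
  refine ⟨measurable_append_conf m, ?_⟩
  refine Measure.AbsolutelyContinuous.mk fun s hs h0 => ?_
  rw [Measure.map_apply (measurable_append_conf m) hs,
    ← lintegral_indicator_one (measurable_append_conf m hs), lintegral_prod_dConf m
      (measurable_one.indicator (measurable_append_conf m hs)), ENNReal.tsum_eq_zero]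
  intro N
  have hs' : MeasurableSet (sector (m + N) ⁻¹' s) := (measurableEmbedding_mk (m + N)).measurable hs
  refine le_antisymm ((lintegral_append_le m N (f := (sector (m + N) ⁻¹' s).indicator 1)
    (measurable_one.indicator hs')).trans ?_) zero_le
  rw [lintegral_indicator_one hs', nonpos_iff_eq_zero]
  have := (lintegral_dConf (s.indicator 1)).symm
  rw [lintegral_indicator_one hs, h0, ENNReal.tsum_eq_zero] at this
  rw [← lintegral_indicator_one hs', ← this (m + N)]
  rfl

lemma photon_abs_nonneg (k : Photon) : 0 ≤ k.abs := norm_nonneg _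

/-- Weights over injective selections are controlled by powers of the sum. -/
lemma sum_embedding_prod_le {m p : ℕ} (a : Fin p → ℝ≥0∞) :
    ∑ j : Fin m ↪ Fin p, ∏ i, a (j i) ≤ (∑ l, a l) ^ m := by
  rw [Fintype.sum_pow]
  have : ∑ j : Fin m ↪ Fin p, ∏ i, a (j i) =
      ∑ f ∈ Finset.univ.map ⟨fun j : Fin m ↪ Fin p => (j : Fin m → Fin p),
        DFunLike.coe_injective⟩, ∏ i, a (f i) := by
    rw [Finset.sum_map]; rfl
  rw [this]
  exact Finset.sum_le_sum_of_subset (Finset.subset_univ _)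

lemma lintegral_symm_weight (m N : ℕ) (ψ : Hred) :
    ∫⁻ y : Fin (m + N) → Photon, ENNReal.ofReal (∏ i : Fin m, (y (Fin.castAdd N i)).abs) *
      ((m + N).descFactorial m * ‖ψ.toLp ⟨m + N, y⟩‖ₑ ^ 2)
        ∂(Measure.pi fun _ : Fin (m + N) => dk) ≤
    ∫⁻ y : Fin (m + N) → Photon, ‖ψ.toLp ⟨m + N, y⟩‖ₑ ^ 2
        ∂(Measure.pi fun _ : Fin (m + N) => dk) := by
  set ν : Measure (Fin (m + N) → Photon) := Measure.pi fun _ : Fin (m + N) => dk with hν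
  have hψm : Measurable fun y : Fin (m + N) → Photon => ψ.toLp ⟨m + N, y⟩ :=
    (Lp.stronglyMeasurable ψ.toLp).measurable.comp
      (measurableEmbedding_mk (m + N)).measurable
  have hW : ∀ j : Fin m ↪ Fin (m + N), Measurable fun y : Fin (m + N) → Photon =>
      (∏ i, ENNReal.ofReal (y (j i)).abs) * ‖ψ.toLp ⟨m + N, y⟩‖ₑ ^ 2 := fun j =>
    (Finset.measurable_fun_prod _ fun i _ =>
      (measurable_abs.comp (measurable_pi_apply (j i))).ennreal_ofReal).mul (hψm.enorm.pow_const 2)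
  let j0 : Fin m ↪ Fin (m + N) := ⟨Fin.castAdd N, Fin.castAdd_injective m N⟩
  have hsame : ∀ j : Fin m ↪ Fin (m + N),
      ∫⁻ y, (∏ i, ENNReal.ofReal (y (j i)).abs) * ‖ψ.toLp ⟨m + N, y⟩‖ₑ ^ 2 ∂ν =
      ∫⁻ y, (∏ i, ENNReal.ofReal (y (j0 i)).abs) * ‖ψ.toLp ⟨m + N, y⟩‖ₑ ^ 2 ∂ν := by
    intro j
    obtain ⟨σ, hσ⟩ := Equiv.Perm.exists_extending_pair j0 j j0.injective j.injective
    rw [← (measurePreserving_perm σ).lintegral_comp (hW j0)]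
    refine lintegral_congr_ae ?_
    filter_upwards [ψ.toLp_mem.1 (m + N) σ] with y hy
    rw [hy]
    simp only [Function.comp, hσ]
  calc _ = ((m + N).descFactorial m : ℝ≥0∞) * ∫⁻ y, (∏ i, ENNReal.ofReal (y (j0 i)).abs) *
        ‖ψ.toLp ⟨m + N, y⟩‖ₑ ^ 2 ∂ν := by
        rw [← lintegral_const_mul _ (hW j0)]
        refine lintegral_congr fun y => ?_
        rw [ENNReal.ofReal_prod_of_nonneg fun i _ => photon_abs_nonneg (y (Fin.castAdd N i))]
        change (∏ i, ENNReal.ofReal (y (j0 i)).abs) * _ = _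
        ring
    _ = ∑ j : Fin m ↪ Fin (m + N), ∫⁻ y, (∏ i, ENNReal.ofReal (y (j i)).abs) *
        ‖ψ.toLp ⟨m + N, y⟩‖ₑ ^ 2 ∂ν := by
        simp_rw [hsame]
        simp [Fintype.card_embedding_eq]
    _ = ∫⁻ y, (∑ j : Fin m ↪ Fin (m + N), ∏ i, ENNReal.ofReal (y (j i)).abs) *
        ‖ψ.toLp ⟨m + N, y⟩‖ₑ ^ 2 ∂ν := by
        simp_rw [Finset.sum_mul]
        rw [lintegral_finsetSum _ fun j _ => hW j]
    _ ≤ ∫⁻ y, ‖ψ.toLp ⟨m + N, y⟩‖ₑ ^ 2 ∂ν := by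
        refine lintegral_mono_ae ?_
        filter_upwards [ae_dConf.1 ψ.toLp_mem.2 (m + N)] with y hy
        rcases lt_or_ge 1 (energy ⟨m + N, y⟩) with h | h
        · rw [hy h]; simp
        · have h1 : (∑ l, ENNReal.ofReal (y l).abs) ≤ 1 := by
            rw [← ENNReal.ofReal_sum_of_nonneg fun i _ => photon_abs_nonneg (y i)]
            exact ENNReal.ofReal_le_one.2 h
          have h2 : ∑ j : Fin m ↪ Fin (m + N), ∏ i, ENNReal.ofReal (y (j i)).abs ≤ 1 :=
            (sum_embedding_prod_le fun l => ENNReal.ofReal (y l).abs).trans (pow_le_one₀ zero_le h1)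
          exact (mul_le_mul' h2 le_rfl).trans_eq (one_mul _)

lemma lintegral_enorm_sq (ψ : Hred) :
    ∫⁻ x, ‖ψ.toLp x‖ₑ ^ 2 ∂dConf = ‖ψ‖ₑ ^ 2 := by
  change _ = ‖ψ.toLp‖ₑ ^ 2
  rw [Lp.enorm_def]
  rw [eLpNorm_eq_lintegral_rpow_enorm_toReal (by simp) (by simp)]
  simp only [ENNReal.toReal_ofNat, one_div, ENNReal.rpow_ofNat]
  rw [← ENNReal.rpow_natCast, ← ENNReal.rpow_mul]
  simp

lemma measurable_annihilate (m : ℕ) (ψ : Hred) :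
    Measurable fun p : (Fin m → Photon) × Conf => annihilate ψ.toLp p.1 p.2 := by
  refine Measurable.mul ?_ ((Lp.stronglyMeasurable ψ.toLp).measurable.comp
    (measurable_append_conf m))
  exact measurable_prod_conf fun n =>
    (measurable_const : Measurable fun _ => (Real.sqrt ((m + n).descFactorial m) : ℂ))

lemma lintegral_annihilate_le (m : ℕ) (ψ : Hred) :
    ∫⁻ z : (Fin m → Photon) × Conf, ENNReal.ofReal (∏ i, (z.1 i).abs) *
      ‖annihilate ψ.toLp z.1 z.2‖ₑ ^ 2
        ∂((Measure.pi fun _ : Fin m => dkB).prod dConf) ≤ ‖ψ‖ₑ ^ 2 := by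
  have hP : Measurable fun k : Fin m → Photon => ENNReal.ofReal (∏ i, (k i).abs) :=
    (Finset.measurable_fun_prod _ fun i _ =>
      measurable_abs.comp (measurable_pi_apply i)).ennreal_ofReal
  have hψm : ∀ p, Measurable fun y : Fin p → Photon => ψ.toLp ⟨p, y⟩ := fun p =>
    (Lp.stronglyMeasurable ψ.toLp).measurable.comp
      (measurableEmbedding_mk p).measurable
  have hG : Measurable fun z : (Fin m → Photon) × Conf => ENNReal.ofReal (∏ i, (z.1 i).abs) *
      ‖annihilate ψ.toLp z.1 z.2‖ₑ ^ 2 :=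
    (hP.comp measurable_fst).mul ((measurable_annihilate m ψ).enorm.pow_const 2)
  rw [lintegral_prod_dConf m hG, ← lintegral_enorm_sq, lintegral_dConf]
  refine (ENNReal.tsum_le_tsum fun N => ?_).trans (ENNReal.tsum_comp_le_tsum_of_injective
    (add_right_injective m) _)
  refine le_trans (le_of_eq ?_) ((lintegral_append_le m N (f := fun y =>
    ENNReal.ofReal (∏ i : Fin m, (y (Fin.castAdd N i)).abs) *
      ((m + N).descFactorial m * ‖ψ.toLp ⟨m + N, y⟩‖ₑ ^ 2)) ?_).trans
      (lintegral_symm_weight m N ψ))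
  · refine lintegral_congr fun x => lintegral_congr fun k => ?_
    simp only [Fin.append_left, annihilate, enorm_mul, mul_pow]
    congr 2
    rw [← ofReal_norm, Complex.norm_real, Real.norm_of_nonneg (Real.sqrt_nonneg _),
      ← ENNReal.ofReal_pow (Real.sqrt_nonneg _), Real.sq_sqrt (Nat.cast_nonneg _),
      ENNReal.ofReal_natCast]
  · exact ((Finset.measurable_fun_prod _ fun i _ => measurable_abs.comp
      (measurable_pi_apply (Fin.castAdd N i))).ennreal_ofReal).mul
      (measurable_const.mul ((hψm _).enorm.pow_const 2))
lemma lintegral_mul_le_sq {α : Type*} [MeasurableSpace α] (μ : Measure α) {f g : α → ℝ≥0∞}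
    (hf : Measurable f) (hg : Measurable g) :
    ∫⁻ a, f a * g a ∂μ ≤
      (∫⁻ a, f a ^ 2 ∂μ) ^ (1 / 2 : ℝ) * (∫⁻ a, g a ^ 2 ∂μ) ^ (1 / 2 : ℝ) := by
  have := ENNReal.lintegral_mul_le_Lp_mul_Lq μ Real.HolderConjugate.two_two hf.aemeasurable
    hg.aemeasurable
  simpa only [Pi.mul_apply, ENNReal.rpow_two] using this

lemma sqrt_sq (a : ℝ≥0∞) : (a ^ (1 / 2 : ℝ)) ^ 2 = a := by
  rw [← ENNReal.rpow_natCast, ← ENNReal.rpow_mul]; simp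

/-- Weighted Cauchy-Schwarz estimate for kernels that depend on two of three variables. -/
lemma lintegral_triple_le {X Y Z : Type*} [MeasurableSpace X] [MeasurableSpace Y]
    [MeasurableSpace Z] (μX : Measure X) (μY : Measure Y) (μZ : Measure Z) [SFinite μX]
    [SFinite μY] [SFinite μZ] {A : X × Z → ℝ≥0∞} {B : Y × Z → ℝ≥0∞} {W : X × Y → ℝ≥0∞}
    (hA : Measurable A) (hB : Measurable B) (hW : Measurable W) {p : X → ℝ≥0∞} {q : Y → ℝ≥0∞}
    (hp : Measurable p) (hq : Measurable q) (hp0 : ∀ᵐ x ∂μX, p x ≠ 0) (hq0 : ∀ᵐ y ∂μY, q y ≠ 0)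
    (hpt : ∀ x, p x ≠ ⊤) (hqt : ∀ y, q y ≠ ⊤) :
    ∫⁻ z, A (z.1, z.2.2) * W (z.1, z.2.1) * B (z.2.1, z.2.2) ∂(μX.prod (μY.prod μZ)) ≤
      (∫⁻ u, W u ^ 2 * (p u.1 * q u.2)⁻¹ ∂(μX.prod μY)) ^ (1 / 2 : ℝ) *
      ((∫⁻ u, p u.1 * A u ^ 2 ∂(μX.prod μZ)) * ∫⁻ u, q u.1 * B u ^ 2 ∂(μY.prod μZ))
        ^ (1 / 2 : ℝ) := by
  set a : X → ℝ≥0∞ := fun x => (∫⁻ z, A (x, z) ^ 2 ∂μZ) ^ (1 / 2 : ℝ) with ha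
  set b : Y → ℝ≥0∞ := fun y => (∫⁻ z, B (y, z) ^ 2 ∂μZ) ^ (1 / 2 : ℝ) with hb
  have ham : Measurable a := ((hA.pow_const 2).lintegral_prod_right').pow_const _
  have hbm : Measurable b := ((hB.pow_const 2).lintegral_prod_right').pow_const _
  have hAx : ∀ x, Measurable fun z => A (x, z) := fun x => hA.comp measurable_prodMk_left
  have hBy : ∀ y, Measurable fun z => B (y, z) := fun y => hB.comp measurable_prodMk_left
  have hF : Measurable fun z : X × Y × Z =>
      A (z.1, z.2.2) * W (z.1, z.2.1) * B (z.2.1, z.2.2) := by fun_prop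
  set s : X × Y → ℝ≥0∞ := fun u => (p u.1 * q u.2) ^ (1 / 2 : ℝ) with hs
  have hsm : Measurable s := by fun_prop
  have hs2 : ∀ u, s u ^ 2 = p u.1 * q u.2 := fun u => sqrt_sq _
  have hst : ∀ u, s u ≠ ⊤ := fun u =>
    ENNReal.rpow_ne_top_of_nonneg (by norm_num) (ENNReal.mul_ne_top (hpt _) (hqt _))
  have hs0 : ∀ᵐ u ∂(μX.prod μY), s u ≠ 0 := by
    filter_upwards [Measure.quasiMeasurePreserving_fst.ae hp0,
      Measure.quasiMeasurePreserving_snd.ae hq0] with u h1 h2 h3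
    have := hs2 u
    rw [h3] at this
    simp only [ne_eq, OfNat.ofNat_ne_zero, not_false_eq_true, zero_pow] at this
    exact (mul_ne_zero h1 h2) this.symm
  calc ∫⁻ z, A (z.1, z.2.2) * W (z.1, z.2.1) * B (z.2.1, z.2.2) ∂(μX.prod (μY.prod μZ))
      = ∫⁻ x, ∫⁻ y, ∫⁻ z, A (x, z) * W (x, y) * B (y, z) ∂μZ ∂μY ∂μX := by
        rw [lintegral_prod _ hF.aemeasurable]
        refine lintegral_congr fun x => ?_
        have hFx : Measurable fun v : Y × Z => A (x, v.2) * W (x, v.1) * B v := by fun_prop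
        exact lintegral_prod _ hFx.aemeasurable
    _ ≤ ∫⁻ x, ∫⁻ y, W (x, y) * (a x * b y) ∂μY ∂μX := by
        refine lintegral_mono fun x => lintegral_mono fun y => ?_
        calc ∫⁻ z, A (x, z) * W (x, y) * B (y, z) ∂μZ
            = W (x, y) * ∫⁻ z, A (x, z) * B (y, z) ∂μZ := by
              have hAB : Measurable fun z => A (x, z) * B (y, z) := (hAx x).mul (hBy y)
              rw [← lintegral_const_mul _ hAB]
              exact lintegral_congr fun z => by ring
          _ ≤ _ := by
              gcongr
              exact lintegral_mul_le_sq μZ (hAx x) (hBy y)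
    _ = ∫⁻ u, W u * (a u.1 * b u.2) ∂(μX.prod μY) := by
        rw [lintegral_prod]
        exact (by fun_prop : Measurable fun u : X × Y => W u * (a u.1 * b u.2)).aemeasurable
    _ = ∫⁻ u, (W u * (s u)⁻¹) * (s u * (a u.1 * b u.2)) ∂(μX.prod μY) := by
        refine lintegral_congr_ae ?_
        filter_upwards [hs0] with u h0
        rw [mul_assoc, ← mul_assoc (s u)⁻¹, ENNReal.inv_mul_cancel h0 (hst u), one_mul]
    _ ≤ _ := lintegral_mul_le_sq _ (by fun_prop) (by fun_prop)
    _ = _ := by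
        congr 2
        · refine lintegral_congr fun u => ?_
          rw [mul_pow, ← ENNReal.inv_pow, hs2]
        · have h1 : ∀ x, ∫⁻ z, p x * A (x, z) ^ 2 ∂μZ = p x * a x ^ 2 := fun x => by
            rw [lintegral_const_mul _ ((hAx x).pow_const 2), sqrt_sq]
          have h2 : ∀ y, ∫⁻ z, q y * B (y, z) ^ 2 ∂μZ = q y * b y ^ 2 := fun y => by
            rw [lintegral_const_mul _ ((hBy y).pow_const 2), sqrt_sq]
          rw [lintegral_prod (fun u : X × Z => p u.1 * A u ^ 2)
            (by fun_prop : Measurable fun u : X × Z => p u.1 * A u ^ 2).aemeasurable,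
            lintegral_prod (fun u : Y × Z => q u.1 * B u ^ 2)
            (by fun_prop : Measurable fun u : Y × Z => q u.1 * B u ^ 2).aemeasurable]
          simp_rw [h1, h2]
          rw [← lintegral_prod_mul (by fun_prop) (by fun_prop)]
          refine lintegral_congr fun u => ?_
          rw [mul_pow, mul_pow, hs2]
          ring

lemma ae_abs_prod_ne_zero (m : ℕ) :
    ∀ᵐ k ∂(Measure.pi fun _ : Fin m => dkB), ∏ i, (k i).abs ≠ 0 := by
  have h0 : ∀ᵐ k ∂dkB, k.abs ≠ 0 := by
    refine ae_restrict_of_ae ?_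
    have : ∀ᵐ v ∂(volume : Measure (EuclideanSpace ℝ (Fin 3))), ‖v‖ ≠ 0 := by
      filter_upwards [Measure.ae_ne volume (0 : EuclideanSpace ℝ (Fin 3))] with v hv
      exact norm_ne_zero_iff.2 hv
    exact Measure.quasiMeasurePreserving_fst.ae this
  have h1 : ∀ᵐ k ∂(Measure.pi fun _ : Fin m => dkB), ∀ i, (k i).abs ≠ 0 :=
    ae_all_iff.2 fun i => (Measure.quasiMeasurePreserving_eval (fun _ : Fin m => dkB) i).ae h0
  filter_upwards [h1] with k hk
  exact Finset.prod_ne_zero_iff.2 fun i _ => hk i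

lemma ae_abs_prod_le_one (m : ℕ) :
    ∀ᵐ k ∂(Measure.pi fun _ : Fin m => dkB), ∏ i, (k i).abs ≤ 1 := by
  have h0 : ∀ᵐ k ∂dkB, k.abs ≤ 1 :=
    ae_restrict_mem (measurableSet_le measurable_abs measurable_const)
  have h1 : ∀ᵐ k ∂(Measure.pi fun _ : Fin m => dkB), ∀ i, (k i).abs ≤ 1 :=
    ae_all_iff.2 fun i => (Measure.quasiMeasurePreserving_eval (fun _ : Fin m => dkB) i).ae h0
  filter_upwards [h1] with k hk
  exact Finset.prod_le_one (fun i _ => photon_abs_nonneg (k i)) fun i _ => hk i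

lemma measurable_abs_prod (m : ℕ) : Measurable fun k : Fin m → Photon => ∏ i, (k i).abs :=
  Finset.measurable_fun_prod _ fun i _ => measurable_abs.comp (measurable_pi_apply i)

lemma abs_prod_nonneg {m : ℕ} (k : Fin m → Photon) : 0 ≤ ∏ i, (k i).abs :=
  Finset.prod_nonneg fun i _ => photon_abs_nonneg (k i)

lemma lintegral_kernel_le (μ : ℝ≥0) (m n : ℕ) (w : Lp C1 2 (kernelMeasure μ m n)) :
    ∫⁻ K, ‖w K‖ₑ ^ 2 * (ENNReal.ofReal (∏ i, (K.1 i).abs) * ENNReal.ofReal (∏ i, (K.2 i).abs))⁻¹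
      ∂((Measure.pi fun _ : Fin m => dkB).prod (Measure.pi fun _ : Fin n => dkB)) ≤ ‖w‖ₑ ^ 2 := by
  have hw : Measurable fun K => ‖w K‖ₑ ^ 2 := (Lp.stronglyMeasurable w).enorm.pow_const 2
  have hd : Measurable fun K : (Fin m → Photon) × (Fin n → Photon) =>
      (ENNReal.ofReal (((∏ i, (K.1 i).abs) * ∏ j, (K.2 j).abs) ^ (2 + 2 * (μ : ℝ))))⁻¹ :=
    (((((measurable_abs_prod m).comp measurable_fst).mul
      ((measurable_abs_prod n).comp measurable_snd)).pow_const _).ennreal_ofReal).inv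
  have hnorm : ‖w‖ₑ ^ 2 = ∫⁻ K, ‖w K‖ₑ ^ 2 ∂(kernelMeasure μ m n) := by
    rw [Lp.enorm_def, eLpNorm_eq_lintegral_rpow_enorm_toReal (by simp) (by simp)]
    simp only [ENNReal.toReal_ofNat, ENNReal.rpow_ofNat]
    rw [sqrt_sq]
  have hwd : ∀ g : (Fin m → Photon) × (Fin n → Photon) → ℝ≥0∞, Measurable g →
      ∫⁻ K, g K ∂(kernelMeasure μ m n) = ∫⁻ K, (ENNReal.ofReal (((∏ i, (K.1 i).abs) *
        ∏ j, (K.2 j).abs) ^ (2 + 2 * (μ : ℝ))))⁻¹ * g K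
        ∂((Measure.pi fun _ : Fin m => dkB).prod (Measure.pi fun _ : Fin n => dkB)) :=
    fun g hg => lintegral_withDensity_eq_lintegral_mul _ hd hg
  rw [hnorm, hwd _ hw]
  refine lintegral_mono_ae ?_
  filter_upwards [Measure.quasiMeasurePreserving_fst.ae (ae_abs_prod_le_one m),
    Measure.quasiMeasurePreserving_snd.ae (ae_abs_prod_le_one n)] with K h1 h2
  rw [mul_comm, ← ENNReal.ofReal_mul (abs_prod_nonneg _)]
  gcongr
  refine Real.rpow_le_self_of_le_one (mul_nonneg (abs_prod_nonneg _) (abs_prod_nonneg _))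
    (mul_le_one₀ h1 (abs_prod_nonneg _) h2) ?_
  have := μ.2
  linarith

section Form

variable {μ : ℝ≥0} {m n : ℕ}

lemma measurable_fn_apply {w : (Fin m → Photon) × (Fin n → Photon) → C1}
    (hw : StronglyMeasurable w) :
    Measurable fun z : (Fin m → Photon) × (Fin n → Photon) × Conf =>
      (w (z.1, z.2.1)).fn (energy01 z.2.2) := by
  have h1 : StronglyMeasurable fun z : (Fin m → Photon) × (Fin n → Photon) × Conf =>
      (w (z.1, z.2.1)).fn :=
    C1.continuous_fn.comp_stronglyMeasurable (hw.comp_measurable (by fun_prop))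
  have h2 : StronglyMeasurable fun z : (Fin m → Photon) × (Fin n → Photon) × Conf =>
      energy01 z.2.2 :=
    (measurable_energy01.comp (measurable_snd.comp measurable_snd)).stronglyMeasurable
  exact (continuous_eval.comp_stronglyMeasurable (h1.prodMk h2)).measurable

lemma measurable_formIntegrand (w : Lp C1 2 (kernelMeasure μ m n)) (φ ψ : Hred) :
    Measurable (formIntegrand w φ.toLp ψ.toLp) := by
  have h1 := (measurable_annihilate m φ).comp
    (measurable_fst.prodMk (measurable_snd.comp measurable_snd) :
      Measurable fun z : (Fin m → Photon) × (Fin n → Photon) × Conf => (z.1, z.2.2))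
  have h2 := (measurable_annihilate n ψ).comp
    (measurable_snd : Measurable fun z : (Fin m → Photon) × (Fin n → Photon) × Conf => z.2)
  exact ((Complex.continuous_conj.measurable.comp h1).mul
    (measurable_fn_apply (Lp.stronglyMeasurable w))).mul h2

lemma lintegral_formIntegrand_le (w : Lp C1 2 (kernelMeasure μ m n)) (φ ψ : Hred) :
    ∫⁻ z, ‖formIntegrand w φ.toLp ψ.toLp z‖ₑ ∂(formMeasure m n) ≤
      ‖w‖ₑ * (‖φ‖ₑ * ‖ψ‖ₑ) := by
  have hw : Measurable fun K => ‖w K‖ₑ := (Lp.stronglyMeasurable w).enorm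
  have key := lintegral_triple_le (Measure.pi fun _ : Fin m => dkB)
    (Measure.pi fun _ : Fin n => dkB) dConf (measurable_annihilate m φ).enorm
    (measurable_annihilate n ψ).enorm hw (measurable_abs_prod m).ennreal_ofReal
    (measurable_abs_prod n).ennreal_ofReal
    (by filter_upwards [ae_abs_prod_ne_zero m] with k hk
        exact (ENNReal.ofReal_pos.2 (lt_of_le_of_ne (abs_prod_nonneg k) hk.symm)).ne')
    (by filter_upwards [ae_abs_prod_ne_zero n] with k hk
        exact (ENNReal.ofReal_pos.2 (lt_of_le_of_ne (abs_prod_nonneg k) hk.symm)).ne')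
    (fun _ => ENNReal.ofReal_ne_top) (fun _ => ENNReal.ofReal_ne_top)
  have hsqrt : ∀ a : ℝ≥0∞, (a ^ 2) ^ (1 / 2 : ℝ) = a := fun a => by
    rw [← ENNReal.rpow_natCast, ← ENNReal.rpow_mul]; simp
  calc _ ≤ ∫⁻ z : (Fin m → Photon) × (Fin n → Photon) × Conf,
        ‖annihilate φ.toLp z.1 z.2.2‖ₑ * ‖w (z.1, z.2.1)‖ₑ *
          ‖annihilate ψ.toLp z.2.1 z.2.2‖ₑ ∂(formMeasure m n) := by
        refine lintegral_mono fun z => ?_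
        rw [formIntegrand, enorm_mul, enorm_mul, RCLike.enorm_conj]
        gcongr
        exact enorm_le_iff_norm_le.2 (C1.norm_fn_apply_le _ _)
    _ ≤ _ := key
    _ ≤ (‖w‖ₑ ^ 2) ^ (1 / 2 : ℝ) * (‖φ‖ₑ ^ 2 * ‖ψ‖ₑ ^ 2) ^ (1 / 2 : ℝ) := by
        gcongr
        · exact lintegral_kernel_le μ m n w
        · exact lintegral_annihilate_le m φ
        · exact lintegral_annihilate_le n ψ
    _ = _ := by rw [← mul_pow, hsqrt, hsqrt]

lemma integrable_formIntegrand (w : Lp C1 2 (kernelMeasure μ m n)) (φ ψ : Hred) :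
    Integrable (formIntegrand w φ.toLp ψ.toLp) (formMeasure m n) :=
  ⟨(measurable_formIntegrand w φ ψ).aestronglyMeasurable,
    (lintegral_formIntegrand_le w φ ψ).trans_lt (by finiteness)⟩

lemma norm_integral_formIntegrand_le (w : Lp C1 2 (kernelMeasure μ m n)) (φ ψ : Hred) :
    ‖∫ z, formIntegrand w φ.toLp ψ.toLp z ∂(formMeasure m n)‖ ≤
      ‖w‖ * ‖φ‖ * ‖ψ‖ := by
  have h := (enorm_integral_le_lintegral_enorm _).trans (lintegral_formIntegrand_le w φ ψ)
  rw [← mul_assoc] at h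
  have h2 := ENNReal.toReal_mono (by finiteness) h
  simpa using h2

lemma annihilate_ae (m : ℕ) {f g : Conf → ℂ} (h : f =ᵐ[dConf] g) :
    ∀ᵐ z ∂((Measure.pi fun _ : Fin m => dkB).prod dConf),
      annihilate f z.1 z.2 = annihilate g z.1 z.2 := by
  filter_upwards [(quasiMeasurePreserving_append m).ae h] with z hz
  rw [annihilate, annihilate, hz]

lemma annihilate_ae_left {f g : Conf → ℂ} (h : f =ᵐ[dConf] g) :
    ∀ᵐ z ∂(formMeasure m n), annihilate f z.1 z.2.2 = annihilate g z.1 z.2.2 := by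
  have hq : Measure.QuasiMeasurePreserving
      (Prod.map id Prod.snd : (Fin m → Photon) × (Fin n → Photon) × Conf → _) (formMeasure m n)
      ((Measure.pi fun _ : Fin m => dkB).prod dConf) :=
    QuasiMeasurePreserving.prodMap (Measure.QuasiMeasurePreserving.id _) Measure.quasiMeasurePreserving_snd
  exact hq.ae (annihilate_ae m h)

lemma annihilate_ae_right {f g : Conf → ℂ} (h : f =ᵐ[dConf] g) :
    ∀ᵐ z ∂(formMeasure m n), annihilate f z.2.1 z.2.2 = annihilate g z.2.1 z.2.2 :=
  Measure.quasiMeasurePreserving_snd.ae (annihilate_ae n h)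

/-- The sesquilinear form of `H_{m,n}(w)`:
`(φ, ψ) ↦ ∫ ⟨a(k) φ, w(H_f, k, k̃) a(k̃) ψ⟩ dk dk̃` over `k ∈ B^m`, `k̃ ∈ B^n`. -/
def formHmn (w : Kernel μ m n) : Hred →L⋆[ℂ] Hred →L[ℂ] ℂ :=
  LinearMap.mkContinuous₂
    (LinearMap.mk₂'ₛₗ (starRingEnd ℂ) (RingHom.id ℂ)
      (fun φ ψ : Hred =>
        ∫ z, formIntegrand w.toLp φ.toLp ψ.toLp z ∂(formMeasure m n))
      (fun φ φ' ψ => by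
        rw [← integral_add (integrable_formIntegrand w.toLp φ ψ) (integrable_formIntegrand w.toLp φ' ψ)]
        refine integral_congr_ae ?_
        filter_upwards [annihilate_ae_left (m := m) (n := n) (Lp.coeFn_add φ.toLp φ'.toLp)] with z hz
        simp only [formIntegrand, Hred.toLp_add, hz]
        simp only [annihilate, Pi.add_apply, mul_add, map_add]
        ring)
      (fun c φ ψ => by
        rw [smul_eq_mul, ← integral_const_mul]
        refine integral_congr_ae ?_
        filter_upwards [annihilate_ae_left (m := m) (n := n) (Lp.coeFn_smul c φ.toLp)] with z hz
        simp only [formIntegrand, Hred.toLp_smul, hz]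
        simp only [annihilate, Pi.smul_apply, smul_eq_mul, map_mul]
        ring)
      (fun φ ψ ψ' => by
        rw [← integral_add (integrable_formIntegrand w.toLp φ ψ) (integrable_formIntegrand w.toLp φ ψ')]
        refine integral_congr_ae ?_
        filter_upwards [annihilate_ae_right (m := m) (n := n) (Lp.coeFn_add ψ.toLp ψ'.toLp)] with z hz
        simp only [formIntegrand, Hred.toLp_add, hz]
        simp only [annihilate, Pi.add_apply, mul_add])
      (fun c φ ψ => by
        rw [RingHom.id_apply, smul_eq_mul, ← integral_const_mul]
        refine integral_congr_ae ?_
        filter_upwards [annihilate_ae_right (m := m) (n := n) (Lp.coeFn_smul c ψ.toLp)] with z hz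
        simp only [formIntegrand, Hred.toLp_smul, hz]
        simp only [annihilate, Pi.smul_apply, smul_eq_mul]
        ring))
    ‖w.toLp‖ (norm_integral_formIntegrand_le w.toLp)

/-- The operator `H_{m,n}(w) = P_red (∫ a^*(k) w(H_f, k, k̃) a(k̃) dk dk̃) P_red` on `H_red`: the
bounded operator with `⟨φ, H_{m,n}(w) ψ⟩ = ∫ ⟨a(k) φ, w(H_f, k, k̃) a(k̃) ψ⟩ dk dk̃`. -/
def Hmn (w : Kernel μ m n) : Hred →L[ℂ] Hred :=
  ContinuousLinearMap.adjoint (InnerProductSpace.continuousLinearMapOfBilin (formHmn w))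

lemma inner_Hmn (w : Kernel μ m n) (φ ψ : Hred) :
    ⟪φ, Hmn w ψ⟫_ℂ =
      ∫ z, formIntegrand w.toLp φ.toLp ψ.toLp z ∂(formMeasure m n) := by
  rw [Hmn, ContinuousLinearMap.adjoint_inner_right,
    InnerProductSpace.continuousLinearMapOfBilin_apply]
  rfl

lemma norm_Hmn_le (w : Kernel μ m n) : ‖Hmn w‖ ≤ ‖w.toLp‖ := by
  refine ContinuousLinearMap.opNorm_le_bound _ (norm_nonneg _) fun ψ => ?_
  have h : ‖⟪Hmn w ψ, Hmn w ψ⟫_ℂ‖ ≤ ‖w.toLp‖ * ‖Hmn w ψ‖ * ‖ψ‖ := by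
    rw [inner_Hmn]
    exact norm_integral_formIntegrand_le w.toLp _ ψ
  have h2 : ∀ φ : Hred, ‖⟪φ, φ⟫_ℂ‖ = ‖φ‖ * ‖φ‖ := fun φ => by
    rw [inner_self_eq_norm_sq_to_K, norm_pow, RCLike.norm_ofReal, abs_norm, sq]
  rw [h2] at h
  rcases (norm_nonneg (Hmn w ψ)).eq_or_lt' with h0 | h0
  · rw [h0]; positivity
  · nlinarith

end Form

/-- The space `W_ξ` of sequences `w = (w_{m,n})` of kernels, with `w_{0,0} ∈ C¹([0, 1])` and
`∑ ξ^{-(m+n)} ‖w_{m,n}‖_μ < ∞`. -/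
structure KernelSeq (μ : ℝ≥0) (ξ : ℝ) where
  /-- The component `w_{0,0}`. -/
  w00 : C1
  /-- The components `w_{m,n}` with `m + n ≥ 1`. -/
  off : ∀ p : {p : ℕ × ℕ // p ≠ 0}, Kernel μ p.1.1 p.1.2
  summable_off : Summable fun p => (ξ ^ (p.1.1 + p.1.2))⁻¹ * ‖(off p).toLp‖

namespace KernelSeq

variable {μ : ℝ≥0} {ξ : ℝ}

/-- The norm `‖w - w_{0,0}‖_{μ,ξ} = ∑_{m+n≥1} ξ^{-(m+n)} ‖w_{m,n}‖_μ`. -/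
def offNorm (w : KernelSeq μ ξ) : ℝ := ∑' p, (ξ ^ (p.1.1 + p.1.2))⁻¹ * ‖(w.off p).toLp‖

/-- `H_{0,0}(w) = w_{0,0}(H_f)`. -/
def H00 (w : KernelSeq μ ξ) : Hred →L[ℂ] Hred := fnHf w.w00.fn

lemma summable_Hmn (hξ : 0 < ξ) (hξ1 : ξ ≤ 1) (w : KernelSeq μ ξ) :
    Summable fun p => Hmn (w.off p) := by
  refine Summable.of_norm_bounded w.summable_off fun p => (norm_Hmn_le _).trans ?_
  exact le_mul_of_one_le_left (norm_nonneg _)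
    ((one_le_inv₀ (pow_pos hξ _)).2 (pow_le_one₀ hξ.le hξ1))

/-- `H(w) = ∑_{m,n} H_{m,n}(w)`, a sum that converges in operator norm for `0 < ξ ≤ 1`. -/
def H (w : KernelSeq μ ξ) : Hred →L[ℂ] Hred := w.H00 + ∑' p, Hmn (w.off p)

end KernelSeq

/-- The polydisc `B(α, β, γ) ⊆ H(W_ξ)` of operators `H(w)` with `|w_{0,0}(0)| ≤ α`,
`‖w_{0,0}' - 1‖_∞ ≤ β` and `‖w - w_{0,0}‖_{μ,ξ} ≤ γ`; here `α = ∞` is allowed. -/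
def polydisc (μ : ℝ≥0) (ξ : ℝ) (α : ℝ≥0∞) (β γ : ℝ) : Set (Hred →L[ℂ] Hred) :=
  {T | ∃ w : KernelSeq μ ξ, T = w.H ∧ ‖w.w00.fn 0‖ₑ ≤ α ∧ ‖w.w00.deriv - 1‖ ≤ β ∧ w.offNorm ≤ γ}

/-- A smooth partition `χ² + χ̄² = 1` of the real line with `χ = 1` on `(-∞, 3/4]` and `χ = 0` on
`[1, ∞)`. -/
structure Cutoff where
  /-- The function `χ`. -/
  chi : ℝ → ℝ
  /-- The function `χ̄`. -/
  chiBar : ℝ → ℝ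
  contDiff_chi : ContDiff ℝ ∞ chi
  contDiff_chiBar : ContDiff ℝ ∞ chiBar
  chi_mem : ∀ t, chi t ∈ Set.Icc (0 : ℝ) 1
  chiBar_mem : ∀ t, chiBar t ∈ Set.Icc (0 : ℝ) 1
  chi_eq_one : ∀ t ≤ 3 / 4, chi t = 1
  chi_eq_zero : ∀ t ≥ 1, chi t = 0
  sq_add_sq : ∀ t, chi t ^ 2 + chiBar t ^ 2 = 1

namespace Cutoff

/-- The operator `χ_ρ = χ(H_f / ρ)`. -/
def op (c : Cutoff) (ρ : ℝ) : Hred →L[ℂ] Hred :=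
  fnHf ⟨fun r => (c.chi (r / ρ) : ℂ), Complex.continuous_ofReal.comp
    (c.contDiff_chi.continuous.comp (continuous_subtype_val.div_const ρ))⟩

/-- The operator `χ̄_ρ = χ̄(H_f / ρ)`. -/
def opBar (c : Cutoff) (ρ : ℝ) : Hred →L[ℂ] Hred :=
  fnHf ⟨fun r => (c.chiBar (r / ρ) : ℂ), Complex.continuous_ofReal.comp
    (c.contDiff_chiBar.continuous.comp (continuous_subtype_val.div_const ρ))⟩

end Cutoff

section Feshbach

variable {E : Type*} [NormedAddCommGroup E] [NormedSpace ℂ E]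

/-- `R` is a bounded inverse of the restriction `A : Y → Y`. -/
structure IsInverseIn (A : E →L[ℂ] E) (Y : Submodule ℂ E) (R : Y →L[ℂ] Y) : Prop where
  mapsTo : ∀ y ∈ Y, A y ∈ Y
  right_inv : ∀ y : Y, A (R y) = y
  left_inv : ∀ y z : Y, A y = z → R z = y

/-- `A` is bounded invertible in the (not necessarily closed) subspace `Y`: it restricts to a
bijection `Y → Y` with bounded inverse. -/
def BoundedInvertibleIn (A : E →L[ℂ] E) (Y : Submodule ℂ E) : Prop :=
  ∃ R : Y →L[ℂ] Y, IsInverseIn A Y R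

open Classical in
/-- The bounded inverse of `A : Y → Y` (zero if there is none). -/
def inverseIn (A : E →L[ℂ] E) (Y : Submodule ℂ E) : Y →L[ℂ] Y :=
  if h : BoundedInvertibleIn A Y then h.choose else 0

/-- Feshbach pairs `(H, T)` for `χ` (and `χ̄`), in the case of everywhere defined bounded operators
`H` and `T`, with `W = H - T` and `H_χ̄ = T + χ̄ W χ̄`: both `χ` and `χ̄` commute with `T`, and `T`
and `H_χ̄` are bounded invertible in `Ran χ̄`. Boundedness of `χ̄ H_χ̄⁻¹ χ̄ W χ` is then automatic. -/
structure FeshbachPair (chi chiBar H T : E →L[ℂ] E) : Prop where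
  comm : chi ∘L T = T ∘L chi
  comm_bar : chiBar ∘L T = T ∘L chiBar
  inv_T : BoundedInvertibleIn T chiBar.range
  inv_H : BoundedInvertibleIn (T + chiBar ∘L (H - T) ∘L chiBar) chiBar.range

/-- The Feshbach map `F_χ(H, T) = T + χ W χ - χ W χ̄ H_χ̄⁻¹ χ̄ W χ`, where `W = H - T`,
`H_χ̄ = T + χ̄ W χ̄` and `H_χ̄⁻¹` is the inverse on `Ran χ̄`. -/
def feshbachMap (chi chiBar H T : E →L[ℂ] E) : E →L[ℂ] E :=
  T + chi ∘L (H - T) ∘L chi -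
    chi ∘L (H - T) ∘L chiBar ∘L chiBar.range.subtypeL ∘L
      inverseIn (T + chiBar ∘L (H - T) ∘L chiBar) chiBar.range ∘L
      (chiBar.codRestrict chiBar.range fun x => ⟨x, rfl⟩) ∘L (H - T) ∘L chi

end Feshbach

/-- The dilation `(n, k₁, …, kₙ) ↦ (n, k₁ / ρ, …, kₙ / ρ)` of photon momenta. -/
def dilateConf (ρ : ℝ) (x : Conf) : Conf := ⟨x.1, fun i => (ρ⁻¹ • (x.2 i).1, (x.2 i).2)⟩

lemma map_dilate_pi {ρ : ℝ} (h0 : 0 < ρ) (n : ℕ) :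
    (Measure.pi fun _ : Fin n => dk).map
      (fun (K : Fin n → Photon) i => (ρ⁻¹ • (K i).1, (K i).2)) =
    ENNReal.ofReal (ρ ^ 3) ^ n • Measure.pi fun _ : Fin n => dk := by
  have hm : Measurable fun k : Photon => ((ρ⁻¹ • k.1, k.2) : Photon) :=
    (measurable_fst.const_smul ρ⁻¹ : Measurable fun k : Photon => ρ⁻¹ • k.1).prodMk measurable_snd
  have h1 : dk.map (fun k : Photon => ((ρ⁻¹ • k.1, k.2) : Photon)) =
      ENNReal.ofReal (ρ ^ 3) • dk := by
    have h := Measure.map_addHaar_smul (volume : Measure (EuclideanSpace ℝ (Fin 3)))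
      (inv_ne_zero h0.ne')
    have h3 := (Measure.map_prod_map (volume : Measure (EuclideanSpace ℝ (Fin 3)))
      (Measure.count : Measure (Fin 2)) (measurable_const_smul ρ⁻¹) measurable_id)
    rw [h, Measure.map_id, Measure.prod_smul_left] at h3
    rw [dk]
    refine h3.symm.trans ?_
    congr 2
    rw [finrank_euclideanSpace_fin, inv_pow, inv_inv, abs_of_pos (pow_pos h0 3)]
  have : SigmaFinite (dk.map fun k : Photon => ((ρ⁻¹ • k.1, k.2) : Photon)) := by
    refine MeasurableEmbedding.sigmaFinite_map ?_
    exact (measurableEmbedding_const_smul₀ (inv_ne_zero h0.ne')).prodMap MeasurableEmbedding.id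
  rw [Measure.pi_map_pi (μ := fun _ : Fin n => dk) (f := fun _ (k : Photon) =>
    ((ρ⁻¹ • k.1, k.2) : Photon)) fun _ => hm.aemeasurable]
  refine Measure.pi_eq fun s _ => ?_
  simp [h1, Measure.pi_pi, Finset.prod_mul_distrib]

lemma measurable_dilate_pi (ρ : ℝ) (n : ℕ) :
    Measurable fun (K : Fin n → Photon) i => ((ρ⁻¹ • (K i).1, (K i).2) : Photon) := by
  refine measurable_pi_lambda _ fun i => ?_
  have h : Measurable fun K : Fin n → Photon => K i := measurable_pi_apply i
  exact ((measurable_fst.comp h).const_smul ρ⁻¹ :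
    Measurable fun K : Fin n → Photon => ρ⁻¹ • (K i).1).prodMk (measurable_snd.comp h)

lemma measurable_dilateConf (ρ : ℝ) : Measurable (dilateConf ρ) :=
  measurable_conf fun n => (measurableEmbedding_mk n).measurable.comp (measurable_dilate_pi ρ n)

lemma ae_dilate_pi {ρ : ℝ} (h0 : 0 < ρ) {n : ℕ} {p : (Fin n → Photon) → Prop}
    (h : ∀ᵐ K ∂(Measure.pi fun _ : Fin n => dk), p K) :
    ∀ᵐ K ∂(Measure.pi fun _ : Fin n => dk), p fun i => (ρ⁻¹ • (K i).1, (K i).2) := by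
  have hq : Measure.QuasiMeasurePreserving
      (fun (K : Fin n → Photon) i => ((ρ⁻¹ • (K i).1, (K i).2) : Photon))
      (Measure.pi fun _ : Fin n => dk) (Measure.pi fun _ : Fin n => dk) :=
    ⟨measurable_dilate_pi ρ n, by
      rw [map_dilate_pi h0]; exact Measure.smul_absolutelyContinuous⟩
  exact hq.ae h

lemma ae_dilateConf {ρ : ℝ} (h0 : 0 < ρ) {p : Conf → Prop} (h : ∀ᵐ x ∂dConf, p x) :
    ∀ᵐ x ∂dConf, p (dilateConf ρ x) :=
  ae_dConf.2 fun n => ae_dilate_pi h0 (ae_dConf.1 h n)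

/-- `(n, K) ↦ ρ^{-3n/2} ψₙ(K / ρ)`. -/
def dilateFn (ρ : ℝ) (ψ : Conf → ℂ) (x : Conf) : ℂ :=
  ((ρ ^ (-(3 * (x.1 : ℝ) / 2)) : ℝ) : ℂ) * ψ (dilateConf ρ x)

lemma lintegral_dilateFn {ρ : ℝ} (h0 : 0 < ρ) {ψ : Conf → ℂ} (hψ : Measurable ψ) :
    ∫⁻ x, ‖dilateFn ρ ψ x‖ₑ ^ 2 ∂dConf = ∫⁻ x, ‖ψ x‖ₑ ^ 2 ∂dConf := by
  rw [lintegral_dConf, lintegral_dConf]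
  refine tsum_congr fun n => ?_
  have hg : Measurable fun K : Fin n → Photon => ‖ψ ⟨n, K⟩‖ₑ ^ 2 :=
    ((hψ.comp (measurableEmbedding_mk n).measurable).enorm).pow_const 2
  have h := lintegral_map (μ := Measure.pi fun _ : Fin n => dk) hg (measurable_dilate_pi ρ n)
  rw [map_dilate_pi h0, lintegral_smul_measure, smul_eq_mul] at h
  have hpos : 0 < ρ ^ (-(3 * (n : ℝ) / 2)) := Real.rpow_pos_of_pos h0 _
  have hc : ‖((ρ ^ (-(3 * (n : ℝ) / 2)) : ℝ) : ℂ)‖ₑ ^ 2 * ENNReal.ofReal (ρ ^ 3) ^ n = 1 := by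
    rw [← ofReal_norm, Complex.norm_real, Real.norm_of_nonneg hpos.le,
      ← ENNReal.ofReal_pow hpos.le, ← ENNReal.ofReal_pow (by positivity),
      ← ENNReal.ofReal_mul (by positivity), ← Real.rpow_natCast (ρ ^ (-(3 * (n : ℝ) / 2))),
      ← Real.rpow_mul h0.le, ← pow_mul, ← Real.rpow_natCast, ← Real.rpow_add h0]
    have : -(3 * (n : ℝ) / 2) * ((2 : ℕ) : ℝ) + ((3 * n : ℕ) : ℝ) = 0 := by push_cast; ring
    rw [this, Real.rpow_zero, ENNReal.ofReal_one]
  calc _ = ∫⁻ K : Fin n → Photon, ‖((ρ ^ (-(3 * (n : ℝ) / 2)) : ℝ) : ℂ)‖ₑ ^ 2 *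
        ‖ψ ⟨n, fun i => (ρ⁻¹ • (K i).1, (K i).2)⟩‖ₑ ^ 2 ∂(Measure.pi fun _ : Fin n => dk) := by
        refine lintegral_congr fun K => ?_
        rw [dilateFn, enorm_mul, mul_pow]
        rfl
    _ = _ := by
        have hg1 : Measurable fun K : Fin n → Photon =>
            ‖ψ ⟨n, fun i => (ρ⁻¹ • (K i).1, (K i).2)⟩‖ₑ ^ 2 := hg.comp (measurable_dilate_pi ρ n)
        rw [lintegral_const_mul _ hg1, ← h, ← mul_assoc, hc, one_mul]

lemma measurable_dilateFn {ρ : ℝ} {ψ : Conf → ℂ} (hψ : Measurable ψ) :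
    Measurable (dilateFn ρ ψ) := by
  refine Measurable.mul ?_ (hψ.comp (measurable_dilateConf ρ))
  exact measurable_conf fun n =>
    (measurable_const : Measurable fun _ => ((ρ ^ (-(3 * (n : ℝ) / 2)) : ℝ) : ℂ))

lemma eLpNorm_dilateFn {ρ : ℝ} (h0 : 0 < ρ) {ψ : Conf → ℂ} (hψ : Measurable ψ) :
    eLpNorm (dilateFn ρ ψ) 2 dConf = eLpNorm ψ 2 dConf := by
  rw [eLpNorm_eq_lintegral_rpow_enorm_toReal (by simp) (by simp),
    eLpNorm_eq_lintegral_rpow_enorm_toReal (by simp) (by simp)]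
  simp only [ENNReal.toReal_ofNat, ENNReal.rpow_ofNat]
  rw [lintegral_dilateFn h0 hψ]

lemma memLp_dilateFn {ρ : ℝ} (h0 : 0 < ρ) (ψ : Hred) : MemLp (dilateFn ρ ψ.toLp) 2 dConf := by
  have hm : Measurable (ψ.toLp : Conf → ℂ) := (Lp.stronglyMeasurable ψ.toLp).measurable
  exact ⟨(measurable_dilateFn hm).aestronglyMeasurable, by
    rw [eLpNorm_dilateFn h0 hm]; exact (Lp.memLp ψ.toLp).2⟩

lemma dilateFn_mem {ρ : ℝ} (h0 : 0 < ρ) (h1 : ρ < 1) (ψ : Hred) :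
    (memLp_dilateFn h0 ψ).toLp ∈ HredSpace := by
  refine ⟨fun n π => ?_, ?_⟩
  · have h := ae_dConf.1 (memLp_dilateFn h0 ψ).coeFn_toLp n
    filter_upwards [h, (measurePreserving_perm π).quasiMeasurePreserving.ae h,
      ae_dilate_pi h0 (ψ.toLp_mem.1 n π)] with K h2 h3 h4
    rw [h2, h3, dilateFn, dilateFn]
    exact congrArg _ h4
  · change ∀ᵐ x ∂dConf, _
    filter_upwards [(memLp_dilateFn h0 ψ).coeFn_toLp, ae_dilateConf h0 ψ.toLp_mem.2]
      with x h2 h3 hx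
    have he : energy (dilateConf ρ x) = ρ⁻¹ * energy x := by
      unfold energy dilateConf Photon.abs
      simp only [norm_smul, norm_inv, Real.norm_of_nonneg h0.le, Finset.mul_sum]
    have : 1 < energy (dilateConf ρ x) := by
      rw [he]
      exact one_lt_mul_of_lt_of_le (one_lt_inv₀ h0 |>.2 h1) hx.le
    rw [h2, dilateFn, h3 this, mul_zero]

/-- The isometry `Γ_ρ^*` from `H_red` onto `H_ρ = Ran χ(H_f ≤ ρ) ⊆ H_red`, the inverse of the
unitary scaling `Γ_ρ = Γ(U_ρ) : H_ρ → H_red` with `(U_ρ f)(k) = ρ^{3/2} f(ρ k)`. Explicitly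
`(Γ_ρ^* ψ)ₙ(K) = ρ^{-3n/2} ψₙ(K / ρ)`. -/
def scalingAdjoint (ρ : ℝ) (h0 : 0 < ρ) (h1 : ρ < 1) : Hred →ₗᵢ[ℂ] Hred where
  toFun ψ := Hred.mk (memLp_dilateFn h0 ψ).toLp (dilateFn_mem h0 h1 ψ)
  map_add' φ ψ := Hred.toLp_injective <| Lp.ext <| by
    change _ =ᵐ[dConf] ↑↑((memLp_dilateFn h0 φ).toLp + (memLp_dilateFn h0 ψ).toLp)
    filter_upwards [(memLp_dilateFn h0 (φ + ψ)).coeFn_toLp, (memLp_dilateFn h0 φ).coeFn_toLp,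
      (memLp_dilateFn h0 ψ).coeFn_toLp,
      Lp.coeFn_add (memLp_dilateFn h0 φ).toLp (memLp_dilateFn h0 ψ).toLp,
      ae_dilateConf h0 (Lp.coeFn_add φ.toLp ψ.toLp)] with x h2 h3 h4 h5 h6
    rw [Hred.toLp_mk, h2, h5, Pi.add_apply, h3, h4, dilateFn, Hred.toLp_add, h6, Pi.add_apply,
      mul_add]
    rfl
  map_smul' c ψ := Hred.toLp_injective <| Lp.ext <| by
    change _ =ᵐ[dConf] ↑↑(c • (memLp_dilateFn h0 ψ).toLp)
    filter_upwards [(memLp_dilateFn h0 (c • ψ)).coeFn_toLp, (memLp_dilateFn h0 ψ).coeFn_toLp,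
      Lp.coeFn_smul c (memLp_dilateFn h0 ψ).toLp,
      ae_dilateConf h0 (Lp.coeFn_smul c ψ.toLp)] with x h2 h3 h5 h6
    rw [Hred.toLp_mk, h2, h5, Pi.smul_apply, h3, dilateFn, Hred.toLp_smul, h6, Pi.smul_apply,
      dilateFn, smul_eq_mul, smul_eq_mul, mul_left_comm]
  norm_map' ψ := by
    change ‖(memLp_dilateFn h0 ψ).toLp‖ = ‖ψ.toLp‖
    rw [Lp.norm_toLp, eLpNorm_dilateFn h0 (Lp.stronglyMeasurable ψ.toLp).measurable, Lp.norm_def]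

/-- The renormalization transformation `R_ρ(H) = ρ⁻¹ Γ_ρ F_{χ_ρ}(H, T) Γ_ρ^*` of an operator `H`
on `H_red` with diagonal part `T`. -/
def renormalize (c : Cutoff) (ρ : ℝ) (h0 : 0 < ρ) (h1 : ρ < 1) (H T : Hred →L[ℂ] Hred) :
    Hred →L[ℂ] Hred :=
  ((ρ⁻¹ : ℝ) : ℂ) •
    (ContinuousLinearMap.adjoint (scalingAdjoint ρ h0 h1).toContinuousLinearMap ∘L
      feshbachMap (c.op ρ) (c.opBar ρ) H T ∘L (scalingAdjoint ρ h0 h1).toContinuousLinearMap)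

/-- Analyticity of a function of several complex variables on a set: at each point of the set, the
function is analytic in each variable separately. -/
def AnalyticInEachVariable {d : ℕ} {E : Type*} [NormedAddCommGroup E] [NormedSpace ℂ E]
    (f : (Fin d → ℂ) → E) (S : Set (Fin d → ℂ)) : Prop :=
  ∀ σ ∈ S, ∀ j : Fin d, AnalyticAt ℂ (fun z => f (Function.update σ j z)) (σ j)

end Renorm
end

/-!
The diagonal part `w_{0,0}(H_f)` can be read off from the operator `H(w)` in a bounded linear way.
Given `r ∈ [0, 1]`, let `φⱼ` be normalized one-photon states whose momenta shrink to a point of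
modulus `r`. Then `⟨φⱼ, w_{0,0}(H_f) φⱼ⟩` tends to `w_{0,0}(r)`, while `⟨φⱼ, H_{m,n}(w) φⱼ⟩` for
`m + n ≥ 1` involves only the restriction of the kernel `w_{m,n}` to shrinking sets whose intersection
is a null set, and so tends to zero. Hence `⟨φⱼ, H(w) φⱼ⟩ → w_{0,0}(r)` (`exists_tendsto_inner_H`),
and linear combinations of the functions `w_{0,0}` are bounded in supremum norm by the same linear
combinations of the operators `H(w)`. In particular the difference quotients of `w_{0,0}` in one
complex variable are Cauchy when those of `H(w)` are; this gives analyticity of `w_{0,0}` with values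
in `C([0, 1])`, and of `w_{0,0}(H_f)`, since `f ↦ f(H_f)` is linear and bounded (`analyticAt_H00`).

For the Feshbach map the point is that `Ran χ̄` need not be closed, so that its bounded operators do
not form a complete algebra. An operator with a bounded inverse on a subspace `Y` of a Hilbert space
is also invertible on the closure of `Y`, and becomes an invertible operator `extendById` on the whole
space if it is extended by the identity on the orthogonal complement
(`IsInverseIn.isUnit_extendById`). With this extension `F_χ(H, T)` becomes a polynomial expression in
`H`, `T` and the inverse of an invertible element of a Banach algebra which depends analytically on
`H` and `T`, and inversion is analytic (`analyticAt_feshbachMap`).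
-/

namespace Renorm

/-! ### Analyticity from domination of difference quotients -/

/-- If the difference quotients of `g` are dominated by those of a differentiable function `h`, then
they are Cauchy, so `g` is differentiable. -/
lemma differentiableAt_of_norm_slope_sub_le {E F : Type*} [NormedAddCommGroup E] [NormedSpace ℂ E]
    [NormedAddCommGroup F] [NormedSpace ℂ F] [CompleteSpace F] {h : ℂ → E} {g : ℂ → F} {z₀ : ℂ}
    (hh : DifferentiableAt ℂ h z₀)
    (hle : ∀ z z', ‖slope g z₀ z - slope g z₀ z'‖ ≤ ‖slope h z₀ z - slope h z₀ z'‖) :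
    DifferentiableAt ℂ g z₀ := by
  have h1 := (hasDerivAt_iff_tendsto_slope.1 hh.hasDerivAt).cauchy_map
  have h2 : Cauchy (map (slope g z₀) (𝓝[≠] z₀)) := by
    rw [cauchy_map_iff, tendsto_uniformity_iff_dist_tendsto_zero] at h1 ⊢
    refine ⟨h1.1, squeeze_zero (fun _ => dist_nonneg) (fun p => ?_) h1.2⟩
    simpa only [dist_eq_norm] using hle p.1 p.2
  obtain ⟨L, hL⟩ := CompleteSpace.complete h2
  exact (hasDerivAt_iff_tendsto_slope.2 hL).differentiableAt

lemma analyticAt_of_norm_slope_sub_le {E F : Type*} [NormedAddCommGroup E] [NormedSpace ℂ E]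
    [CompleteSpace E] [NormedAddCommGroup F] [NormedSpace ℂ F] [CompleteSpace F] {h : ℂ → E}
    {g : ℂ → F} {z₀ : ℂ} (hh : AnalyticAt ℂ h z₀)
    (hle : ∀ a z z', ‖slope g a z - slope g a z'‖ ≤ ‖slope h a z - slope h a z'‖) :
    AnalyticAt ℂ g z₀ := by
  rw [Complex.analyticAt_iff_eventually_differentiableAt] at hh ⊢
  filter_upwards [hh] with a ha
  exact differentiableAt_of_norm_slope_sub_le ha (hle a)

/-! ### Inverses on a subspace that need not be closed -/

section Inverse

variable {E : Type*} [NormedAddCommGroup E] [InnerProductSpace ℂ E] [CompleteSpace E]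

/-- The extension of `A`, which is to map `Y` to itself, from the closure of `Y` to the whole space
by the identity on the orthogonal complement of `Y`. -/
noncomputable def extendById (A : E →L[ℂ] E) (Y : Submodule ℂ E) : E →L[ℂ] E :=
  A * Y.topologicalClosure.starProjection + (1 - Y.topologicalClosure.starProjection)

lemma extendById_apply_of_mem (A : E →L[ℂ] E) {Y : Submodule ℂ E} {x : E}
    (hx : x ∈ Y.topologicalClosure) : extendById A Y x = A x := by
  have h : Y.topologicalClosure.starProjection x = x := Submodule.starProjection_eq_self_iff.2 hx
  simp [extendById, h]

/-- A bounded inverse on `Y` gives a lower bound for `A` on `Y`, hence on the closure of `Y`, so that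
`extendById A Y` is bounded below; its range contains the dense subspace `Y + Yᗮ`. -/
lemma IsInverseIn.isUnit_extendById {A : E →L[ℂ] E} {Y : Submodule ℂ E} {R : Y →L[ℂ] Y}
    (h : IsInverseIn A Y R) : IsUnit (extendById A Y) := by
  set Z := Y.topologicalClosure with hZ
  set P := Z.starProjection with hP
  have hAZ : ∀ x ∈ Z, A x ∈ Z := fun x hx =>
    map_mem_closure A.continuous hx fun y hy => h.mapsTo y hy
  have hlow : ∀ x ∈ Z, ‖x‖ ≤ ‖R‖ * ‖A x‖ := by
    intro x hx
    have hcl : IsClosed {x : E | ‖x‖ ≤ ‖R‖ * ‖A x‖} := isClosed_le (by fun_prop) (by fun_prop)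
    refine closure_minimal (fun y hy => ?_) hcl hx
    have hR : R ⟨A y, h.mapsTo y hy⟩ = ⟨y, hy⟩ := h.left_inv ⟨y, hy⟩ ⟨A y, _⟩ rfl
    have := R.le_opNorm ⟨A y, h.mapsTo y hy⟩
    rwa [hR] at this
  -- The extension acts diagonally with respect to `Z` and its complement.
  have hPext : ∀ x, P (extendById A Y x) = A (P x) := by
    intro x
    have h1 : P (A (P x)) = A (P x) :=
      Submodule.starProjection_eq_self_iff.2 (hAZ _ (Z.starProjection_apply_mem x))
    have h2 : P (P x) = P x :=
      Submodule.starProjection_eq_self_iff.2 (Z.starProjection_apply_mem x)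
    change P (A (P x) + (x - P x)) = _
    rw [map_add, map_sub, h1, h2, sub_self, add_zero]
  have hQext : ∀ x, x - P x = extendById A Y x - P (extendById A Y x) := by
    intro x
    rw [hPext]
    change _ = A (P x) + (x - P x) - A (P x)
    abel
  have hPle : ∀ x, ‖P x‖ ≤ ‖x‖ := fun x => Z.norm_starProjection_apply_le x
  have hbelow : ∀ x, ‖x‖ ≤ (‖R‖ + 2) * ‖extendById A Y x‖ := by
    intro x
    have h1 := hlow (P x) (Z.starProjection_apply_mem x)
    rw [← hPext] at h1
    have h2 : ‖x - P x‖ ≤ ‖extendById A Y x‖ + ‖extendById A Y x‖ := by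
      rw [hQext]
      exact (norm_sub_le _ _).trans (by gcongr; exact hPle _)
    have h3 : ‖x‖ ≤ ‖P x‖ + ‖x - P x‖ := by
      simpa using norm_add_le (P x) (x - P x)
    have h4 := mul_le_mul_of_nonneg_left (hPle (extendById A Y x)) (norm_nonneg R)
    linarith
  have hanti : AntilipschitzWith (‖R‖ + 2).toNNReal (extendById A Y) :=
    AddMonoidHomClass.antilipschitz_of_bound _ fun x => by
      rw [Real.coe_toNNReal _ (by positivity)]
      exact hbelow x
  have hclosed : IsClosed (Set.range (extendById A Y)) :=
    hanti.isClosed_range (extendById A Y).uniformContinuous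
  have hY : (Y : Set E) ⊆ Set.range (extendById A Y) := fun y hy => ⟨R ⟨y, hy⟩, by
    rw [extendById_apply_of_mem A (Y.le_topologicalClosure (R ⟨y, hy⟩).2)]
    exact h.right_inv ⟨y, hy⟩⟩
  rw [ContinuousLinearMap.isUnit_iff_bijective]
  refine ⟨hanti.injective, fun y => ?_⟩
  obtain ⟨u, hu⟩ := closure_minimal hY hclosed (Z.starProjection_apply_mem y)
  have hQ : P (y - P y) = 0 := by
    have h2 : P (P y) = P y :=
      Submodule.starProjection_eq_self_iff.2 (Z.starProjection_apply_mem y)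
    rw [map_sub, h2, sub_self]
  refine ⟨u + (y - P y), ?_⟩
  have hfix : extendById A Y (y - P y) = y - P y := by
    change A (P (y - P y)) + ((y - P y) - P (y - P y)) = _
    rw [hQ, map_zero, zero_add, sub_zero]
  rw [map_add, hu, hfix]
  abel

lemma inverseIn_apply {A : E →L[ℂ] E} {Y : Submodule ℂ E} (h : BoundedInvertibleIn A Y) (y : Y) :
    (inverseIn A Y y : E) = Ring.inverse (extendById A Y) y := by
  have hR : IsInverseIn A Y (inverseIn A Y) := by
    rw [inverseIn, dif_pos h]
    exact h.choose_spec
  have h1 : extendById A Y (inverseIn A Y y) = y := by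
    rw [extendById_apply_of_mem A (Y.le_topologicalClosure (inverseIn A Y y).2)]
    exact hR.right_inv y
  have h2 := Ring.inverse_mul_cancel _ hR.isUnit_extendById
  conv_rhs => rw [← h1]
  exact (DFunLike.congr_fun h2 (inverseIn A Y y : E)).symm

end Inverse

/-! ### Analyticity of the Feshbach map -/

section FeshbachAnalytic

variable {E : Type*} [NormedAddCommGroup E] [InnerProductSpace ℂ E] [CompleteSpace E]

lemma FeshbachPair.feshbachMap_eq {chi chiBar H T : E →L[ℂ] E}
    (h : FeshbachPair chi chiBar H T) :
    feshbachMap chi chiBar H T = T + chi * (H - T) * chi -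
      chi * (H - T) * chiBar *
        Ring.inverse (extendById (T + chiBar * (H - T) * chiBar) chiBar.range) *
        chiBar * (H - T) * chi := by
  ext x
  have := inverseIn_apply h.inv_H ⟨chiBar ((H - T) (chi x)), ⟨_, rfl⟩⟩
  exact congrArg (fun v => T x + chi ((H - T) (chi x)) - chi ((H - T) (chiBar v))) this

lemma analyticAt_feshbachMap {chi chiBar : E →L[ℂ] E} {H T : ℂ → E →L[ℂ] E} {z₀ : ℂ}
    (hH : AnalyticAt ℂ H z₀) (hT : AnalyticAt ℂ T z₀)
    (hF : ∀ᶠ z in 𝓝 z₀, FeshbachPair chi chiBar (H z) (T z)) :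
    AnalyticAt ℂ (fun z => feshbachMap chi chiBar (H z) (T z)) z₀ := by
  have hunit : IsUnit (extendById (T z₀ + chiBar * (H z₀ - T z₀) * chiBar) chiBar.range) := by
    obtain ⟨R, hR⟩ := hF.self_of_nhds.inv_H
    exact hR.isUnit_extendById
  have hA : AnalyticAt ℂ
      (fun z => extendById (T z + chiBar * (H z - T z) * chiBar) chiBar.range) z₀ := by
    unfold extendById
    fun_prop
  have hinv : AnalyticAt ℂ (fun z => Ring.inverse
      (extendById (T z + chiBar * (H z - T z) * chiBar) chiBar.range)) z₀ := by
    obtain ⟨u, hu⟩ := hunit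
    have := analyticAt_inverse (𝕜 := ℂ) u
    rw [hu] at this
    exact this.comp (f := fun z => extendById (T z + chiBar * (H z - T z) * chiBar)
      chiBar.range) hA
  have hmain : AnalyticAt ℂ (fun z => T z + chi * (H z - T z) * chi -
      chi * (H z - T z) * chiBar *
        Ring.inverse (extendById (T z + chiBar * (H z - T z) * chiBar) chiBar.range) *
        chiBar * (H z - T z) * chi) z₀ := by
    fun_prop
  refine hmain.congr ?_
  filter_upwards [hF] with z hz
  exact hz.feshbachMap_eq.symm

end FeshbachAnalytic

/-! ### Bounded linearity of the functional calculus -/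

lemma norm_fnHf_le (f : C(I01, ℂ)) : ‖fnHf f‖ ≤ ‖f‖ :=
  LinearMap.mkContinuous_norm_le _ (norm_nonneg f) _

/-- The functional calculus `f ↦ f(H_f)` as a bounded linear map. -/
noncomputable def fnHfL : C(I01, ℂ) →L[ℂ] Hred →L[ℂ] Hred :=
  LinearMap.mkContinuous
    { toFun := fnHf
      map_add' := fun f g => by
        ext ψ
        refine Hred.toLp_injective <| Lp.ext ?_
        change _ =ᵐ[dConf] ↑↑((fnHf f ψ).toLp + (fnHf g ψ).toLp)
        filter_upwards [fnHf_coe (f + g) ψ, fnHf_coe f ψ, fnHf_coe g ψ,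
          Lp.coeFn_add (fnHf f ψ).toLp (fnHf g ψ).toLp] with x h1 h2 h3 h4
        rw [h1, h4, Pi.add_apply, h2, h3, ContinuousMap.add_apply, add_mul]
      map_smul' := fun c f => by
        ext ψ
        refine Hred.toLp_injective <| Lp.ext ?_
        change _ =ᵐ[dConf] ↑↑(c • (fnHf f ψ).toLp)
        filter_upwards [fnHf_coe (c • f) ψ, fnHf_coe f ψ, Lp.coeFn_smul c (fnHf f ψ).toLp]
          with x h1 h2 h3
        rw [h1, h3, Pi.smul_apply, h2, ContinuousMap.smul_apply, smul_eq_mul, smul_eq_mul,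
          mul_assoc] }
    1 fun f => by rw [one_mul]; exact norm_fnHf_le f

/-! ### States localized in momentum space -/

/-- There is a normalized one-photon state whose photon momentum lies in a given nonempty open
subset of the unit ball. -/
lemma exists_localized_state {U : Set (EuclideanSpace ℝ (Fin 3))} (hU : IsOpen U)
    (hne : U.Nonempty) (hU1 : U ⊆ Metric.ball 0 1) :
    ∃ φ : Hred, ‖φ‖ = 1 ∧
      ∀ᵐ x ∂dConf, φ.toLp x ≠ 0 → x.1 = 1 ∧ ∀ i, (x.2 i).1 ∈ U := by
  set A : Set Photon := U ×ˢ Set.univ with hA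
  have hAm : MeasurableSet A := hU.measurableSet.prod MeasurableSet.univ
  set s : Set Conf := sector 1 '' Set.pi Set.univ fun _ => A with hs
  have hsm : MeasurableSet s :=
    (measurableEmbedding_mk 1).measurableSet_image.2 (MeasurableSet.univ_pi fun _ => hAm)
  have hmem : ∀ x : Conf, x ∈ s ↔ x.1 = 1 ∧ ∀ i, (x.2 i).1 ∈ U := by
    rintro ⟨n, K⟩
    constructor
    · rintro ⟨L, hL, he⟩
      rw [← he]
      exact ⟨rfl, fun i => (hL i trivial).1⟩
    · rintro ⟨h1, h2⟩
      obtain rfl : n = 1 := h1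
      exact ⟨K, fun i _ => ⟨h2 i, trivial⟩, rfl⟩
  have hμ : dConf s = volume U * 2 := by
    rw [dConf, Measure.sum_apply _ hsm, tsum_eq_single 1]
    · rw [(measurableEmbedding_mk 1).map_apply, hs,
        Set.preimage_image_eq _ (measurableEmbedding_mk 1).injective, Measure.pi_pi]
      simp [dk, hA, Measure.prod_prod]
    · intro n hn
      rw [(measurableEmbedding_mk n).map_apply]
      have : sector n ⁻¹' s = ∅ := by
        ext K
        simp only [Set.mem_preimage, hmem, Set.mem_empty_iff_false, iff_false]
        exact fun h => hn h.1
      rw [this, measure_empty]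
  have hfin : dConf s ≠ ⊤ := by
    rw [hμ]
    exact ENNReal.mul_ne_top ((measure_mono hU1).trans_lt measure_ball_lt_top).ne (by simp)
  have hpos : dConf s ≠ 0 := by
    rw [hμ]
    exact mul_ne_zero (hU.measure_pos _ hne).ne' (by simp)
  set ψ : Lp ℂ 2 dConf := indicatorConstLp 2 hsm hfin (1 : ℂ) with hψ
  have hψs : ∀ᵐ x ∂dConf, ψ x = s.indicator (fun _ => 1) x := indicatorConstLp_coeFn
  have hmemH : ψ ∈ HredSpace := by
    refine ⟨fun n π => ?_, ?_⟩
    · have h := ae_dConf.1 hψs n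
      filter_upwards [h, (measurePreserving_perm π).quasiMeasurePreserving.ae h] with K h1 h2
      have : (⟨n, K ∘ π⟩ : Conf) ∈ s ↔ (⟨n, K⟩ : Conf) ∈ s := by
        rw [hmem, hmem]
        exact and_congr_right fun _ => ⟨fun h i => by simpa using h (π.symm i), fun h i => h (π i)⟩
      rw [h1, h2]
      by_cases hK : (⟨n, K⟩ : Conf) ∈ s
      · rw [Set.indicator_of_mem hK, Set.indicator_of_mem (this.2 hK)]
      · rw [Set.indicator_of_notMem hK, Set.indicator_of_notMem (this.not.2 hK)]
    · change ∀ᵐ x ∂dConf, _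
      filter_upwards [hψs] with x hx he
      rw [hx, Set.indicator_of_notMem]
      rintro ⟨K, hK, rfl⟩
      have h1 : energy (sector 1 K) = ‖(K 0).1‖ := by
        change ∑ i : Fin 1, ‖(K i).1‖ = _
        rw [Fin.sum_univ_one]
      have h2 := hU1 (hK 0 trivial).1
      rw [mem_ball_zero_iff, ← h1] at h2
      exact absurd he h2.le.not_gt
  set φ : Hred := Hred.mk ψ hmemH with hφ
  have hφ0 : φ ≠ 0 := by
    rw [← norm_ne_zero_iff]
    change ‖ψ‖ ≠ 0
    rw [hψ, norm_indicatorConstLp (by simp) (by simp), norm_one, one_mul]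
    exact (Real.rpow_pos_of_pos (ENNReal.toReal_pos hpos hfin) _).ne'
  refine ⟨((‖φ‖⁻¹ : ℝ) : ℂ) • φ, ?_, ?_⟩
  · rw [norm_smul, Complex.norm_real, norm_inv, norm_norm,
      inv_mul_cancel₀ (norm_ne_zero_iff.2 hφ0)]
  · filter_upwards [hψs, Lp.coeFn_smul ((‖φ‖⁻¹ : ℝ) : ℂ) ψ] with x h1 h2 h3
    rw [← hmem]
    by_contra hx
    apply h3
    rw [Hred.toLp_smul]
    refine h2.trans ?_
    rw [Pi.smul_apply, h1, Set.indicator_of_notMem hx, smul_zero]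

/-- `⟨φ, f(H_f) φ⟩` is close to `c` for normalized `φ` if `f` is close to `c` at the energies
occurring in `φ`. -/
lemma norm_inner_fnHf_sub_le {f : C(I01, ℂ)} {c : ℂ} {ε : ℝ} {φ : Hred}
    (hφ : ‖φ‖ = 1) (h : ∀ᵐ x ∂dConf, φ.toLp x ≠ 0 → ‖f (energy01 x) - c‖ ≤ ε) :
    ‖⟪φ, fnHf f φ⟫_ℂ - c‖ ≤ ε := by
  have h1 : ⟪φ, fnHf f φ⟫_ℂ - c = ⟪φ, fnHf f φ - c • φ⟫_ℂ := by
    rw [inner_sub_right, inner_smul_right, inner_self_eq_norm_sq_to_K, hφ]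
    simp
  have h2 : ‖fnHf f φ - c • φ‖ ≤ ε * ‖φ‖ := by
    refine Lp.norm_le_mul_norm_of_ae_le_mul (f := (fnHf f φ).toLp - c • φ.toLp) (g := φ.toLp) ?_
    filter_upwards [h, fnHf_coe f φ, Lp.coeFn_sub (fnHf f φ).toLp (c • φ.toLp),
      Lp.coeFn_smul c φ.toLp] with x h1 h2 h3 h4
    rw [h3, Pi.sub_apply, h4, h2, Pi.smul_apply, smul_eq_mul, ← sub_mul, norm_mul]
    by_cases h0 : φ.toLp x = 0
    · simp [h0]
    · gcongr
      exact h1 h0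
  rw [h1]
  refine (norm_inner_le_norm _ _).trans ?_
  rw [hφ, mul_one] at h2
  rwa [hφ, one_mul]

/-! ### Interaction terms between localized states -/

/-- The kernel variables all of whose momenta lie in `U`. -/
def localizedKernelSet (U : Set (EuclideanSpace ℝ (Fin 3))) (m n : ℕ) :
    Set ((Fin m → Photon) × (Fin n → Photon)) :=
  {K | (∀ i, (K.1 i).1 ∈ U) ∧ ∀ j, (K.2 j).1 ∈ U}

lemma measurableSet_localizedKernelSet {U : Set (EuclideanSpace ℝ (Fin 3))}
    (hU : MeasurableSet U) (m n : ℕ) : MeasurableSet (localizedKernelSet U m n) := by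
  have h1 : ∀ i, Measurable fun K : (Fin m → Photon) × (Fin n → Photon) => (K.1 i).1 := fun i =>
    measurable_fst.comp ((measurable_pi_apply i).comp measurable_fst)
  have h2 : ∀ j, Measurable fun K : (Fin m → Photon) × (Fin n → Photon) => (K.2 j).1 := fun j =>
    measurable_fst.comp ((measurable_pi_apply j).comp measurable_snd)
  have : localizedKernelSet U m n =
      (⋂ i, (fun K : (Fin m → Photon) × (Fin n → Photon) => (K.1 i).1) ⁻¹' U) ∩
        ⋂ j, (fun K : (Fin m → Photon) × (Fin n → Photon) => (K.2 j).1) ⁻¹' U := by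
    ext K
    simp [localizedKernelSet]
  rw [this]
  exact (MeasurableSet.iInter fun i => h1 i hU).inter (MeasurableSet.iInter fun j => h2 j hU)

lemma absolutelyContinuous_kernelMeasure (μ : ℝ≥0) (m n : ℕ) :
    (Measure.pi fun _ : Fin m => dkB).prod (Measure.pi fun _ : Fin n => dkB) ≪
      kernelMeasure μ m n := by
  refine withDensity_absolutelyContinuous' ?_ (ae_of_all _ fun K => by simp)
  exact (((((measurable_abs_prod m).comp measurable_fst).mul
    ((measurable_abs_prod n).comp measurable_snd)).pow_const _).ennreal_ofReal).inv.aemeasurable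

lemma ae_formMeasure_of_ae_kernelMeasure {μ : ℝ≥0} {m n : ℕ}
    {p : (Fin m → Photon) × (Fin n → Photon) → Prop} (h : ∀ᵐ K ∂(kernelMeasure μ m n), p K) :
    ∀ᵐ z ∂(formMeasure m n), p (z.1, z.2.1) := by
  have hq : Measure.QuasiMeasurePreserving
      (Prod.map id Prod.fst : (Fin m → Photon) × (Fin n → Photon) × Conf → _) (formMeasure m n)
      ((Measure.pi fun _ : Fin m => dkB).prod (Measure.pi fun _ : Fin n => dkB)) :=
    QuasiMeasurePreserving.prodMap (Measure.QuasiMeasurePreserving.id _)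
      Measure.quasiMeasurePreserving_fst
  exact hq.ae (absolutelyContinuous_kernelMeasure μ m n |>.ae_le h)

/-- If all momenta occurring in `φ` lie in `U`, then `⟨φ, H_{m,n}(w) φ⟩` sees only the restriction of
the kernel to momenta in `U`. -/
lemma norm_inner_Hmn_le {μ : ℝ≥0} {m n : ℕ} (w : Kernel μ m n)
    {U : Set (EuclideanSpace ℝ (Fin 3))} (hU : MeasurableSet U) {φ : Hred} (hφ1 : ‖φ‖ = 1)
    (hφ : ∀ᵐ x ∂dConf, φ.toLp x ≠ 0 → ∀ i, (x.2 i).1 ∈ U) :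
    ‖⟪φ, Hmn w φ⟫_ℂ‖ ≤ (eLpNorm ((localizedKernelSet U m n).indicator w.toLp) 2
      (kernelMeasure μ m n)).toReal := by
  have hm := measurableSet_localizedKernelSet hU m n
  set v : Lp C1 2 (kernelMeasure μ m n) := ((Lp.memLp w.toLp).indicator hm).toLp with hv
  have hφ' : ∀ᵐ x ∂dConf, φ.toLp x = {x : Conf | ∀ i, (x.2 i).1 ∈ U}.indicator φ.toLp x := by
    filter_upwards [hφ] with x hx
    by_cases h : ∀ i, (x.2 i).1 ∈ U
    · rw [Set.indicator_of_mem (by exact h)]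
    · rw [Set.indicator_of_notMem (by exact h)]
      by_contra h0
      exact h (hx h0)
  have hint : ∫ z, formIntegrand w.toLp φ.toLp φ.toLp z ∂(formMeasure m n) =
      ∫ z, formIntegrand v φ.toLp φ.toLp z ∂(formMeasure m n) := by
    refine integral_congr_ae ?_
    filter_upwards [annihilate_ae_left (m := m) (n := n) hφ',
      annihilate_ae_right (m := m) (n := n) hφ',
      ae_formMeasure_of_ae_kernelMeasure ((Lp.memLp w.toLp).indicator hm).coeFn_toLp]
      with z h1 h2 h3
    unfold formIntegrand
    rw [hv, h3]
    by_cases hz : (z.1, z.2.1) ∈ localizedKernelSet U m n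
    · rw [Set.indicator_of_mem hz]
    -- Off the localized set some annihilated photon has momentum outside `U`.
    · have hzero : annihilate φ.toLp z.1 z.2.2 = 0 ∨ annihilate φ.toLp z.2.1 z.2.2 = 0 := by
        by_contra! hcon
        refine hz ⟨fun i => ?_, fun j => ?_⟩
        · have h4 : (⟨m + z.2.2.1, Fin.append z.1 z.2.2.2⟩ : Conf) ∈
              {x : Conf | ∀ i, (x.2 i).1 ∈ U} := by
            by_contra hx
            exact hcon.1 (by rw [h1, annihilate, Set.indicator_of_notMem hx, mul_zero])
          simpa using h4 (Fin.castAdd _ i)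
        · have h4 : (⟨n + z.2.2.1, Fin.append z.2.1 z.2.2.2⟩ : Conf) ∈
              {x : Conf | ∀ i, (x.2 i).1 ∈ U} := by
            by_contra hx
            exact hcon.2 (by rw [h2, annihilate, Set.indicator_of_notMem hx, mul_zero])
          simpa using h4 (Fin.castAdd _ j)
      rcases hzero with h0 | h0 <;> simp [h0]
  rw [inner_Hmn, hint]
  refine (norm_integral_formIntegrand_le v φ φ).trans_eq ?_
  rw [hφ1, mul_one, mul_one, hv, Lp.norm_toLp]

lemma ae_momentum_ne (m : ℕ) (k₀ : EuclideanSpace ℝ (Fin 3)) :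
    ∀ᵐ k ∂(Measure.pi fun _ : Fin m => dkB), ∀ i, (k i).1 ≠ k₀ := by
  have h0 : ∀ᵐ k ∂dkB, k.1 ≠ k₀ :=
    ae_restrict_of_ae (Measure.quasiMeasurePreserving_fst.ae (Measure.ae_ne volume k₀))
  exact ae_all_iff.2 fun i =>
    (Measure.quasiMeasurePreserving_eval (fun _ : Fin m => dkB) i).ae h0

/-- The momentum neighbourhoods of `k₀` in the unit ball which shrink to `k₀`. -/
def momentumNhd (k₀ : EuclideanSpace ℝ (Fin 3)) (j : ℕ) : Set (EuclideanSpace ℝ (Fin 3)) :=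
  Metric.ball k₀ (1 / ((j : ℝ) + 1)) ∩ Metric.ball 0 1

lemma isOpen_momentumNhd (k₀ : EuclideanSpace ℝ (Fin 3)) (j : ℕ) : IsOpen (momentumNhd k₀ j) :=
  Metric.isOpen_ball.inter Metric.isOpen_ball

lemma momentumNhd_nonempty {k₀ : EuclideanSpace ℝ (Fin 3)} (hk₀ : ‖k₀‖ ≤ 1) (j : ℕ) :
    (momentumNhd k₀ j).Nonempty := by
  have h : k₀ ∈ closure (Metric.ball (0 : EuclideanSpace ℝ (Fin 3)) 1) := by
    rw [closure_ball _ one_ne_zero]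
    simpa using hk₀
  exact mem_closure_iff.1 h _ Metric.isOpen_ball (Metric.mem_ball_self (by positivity))

lemma eventually_notMem_momentumNhd {k k₀ : EuclideanSpace ℝ (Fin 3)} (h : k ≠ k₀) :
    ∀ᶠ j in atTop, k ∉ momentumNhd k₀ j := by
  have h1 := (tendsto_one_div_add_atTop_nhds_zero_nat (𝕜 := ℝ)).eventually_lt_const
    (dist_pos.2 h)
  filter_upwards [h1] with j hj hk
  exact (Metric.mem_ball.1 hk.1).not_gt hj

/-- For `m + n ≥ 1` a single value of the momenta is a null set, so that a square integrable kernel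
restricted to shrinking neighbourhoods of it tends to zero. -/
lemma tendsto_eLpNorm_localized {μ : ℝ≥0} {m n : ℕ} (hmn : (m, n) ≠ 0)
    (w : Lp C1 2 (kernelMeasure μ m n)) (k₀ : EuclideanSpace ℝ (Fin 3)) :
    Tendsto (fun j => (eLpNorm ((localizedKernelSet (momentumNhd k₀ j) m n).indicator w) 2
      (kernelMeasure μ m n)).toReal) atTop (𝓝 0) := by
  have hw : StronglyMeasurable w := Lp.stronglyMeasurable w
  have hm : ∀ j, MeasurableSet (localizedKernelSet (momentumNhd k₀ j) m n) := fun j =>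
    measurableSet_localizedKernelSet (isOpen_momentumNhd k₀ j).measurableSet m n
  have hbase : ∀ᵐ K ∂((Measure.pi fun _ : Fin m => dkB).prod (Measure.pi fun _ : Fin n => dkB)),
      ∀ᶠ j in atTop, K ∉ localizedKernelSet (momentumNhd k₀ j) m n := by
    filter_upwards [Measure.quasiMeasurePreserving_fst.ae (ae_momentum_ne m k₀),
      Measure.quasiMeasurePreserving_snd.ae (ae_momentum_ne n k₀)] with K h1 h2
    rcases Nat.eq_zero_or_pos m with rfl | hm0
    · have hn0 : 0 < n := Nat.pos_of_ne_zero fun h => hmn (by rw [h]; rfl)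
      filter_upwards [eventually_notMem_momentumNhd (h2 ⟨0, hn0⟩)] with j hj hK
      exact hj (hK.2 _)
    · filter_upwards [eventually_notMem_momentumNhd (h1 ⟨0, hm0⟩)] with j hj hK
      exact hj (hK.1 _)
  have hae : ∀ᵐ K ∂(kernelMeasure μ m n),
      ∀ᶠ j in atTop, K ∉ localizedKernelSet (momentumNhd k₀ j) m n :=
    (withDensity_absolutelyContinuous _ _).ae_le hbase
  have hfin : ∫⁻ K, ‖w K‖ₑ ^ 2 ∂(kernelMeasure μ m n) ≠ ⊤ := by
    have h := lintegral_rpow_enorm_lt_top_of_eLpNorm_lt_top (by simp) (by simp) (Lp.memLp w).2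
    simpa using h.ne
  have hlim : Tendsto (fun j => ∫⁻ K,
      ‖(localizedKernelSet (momentumNhd k₀ j) m n).indicator w K‖ₑ ^ 2 ∂(kernelMeasure μ m n))
      atTop (𝓝 (∫⁻ _, 0 ∂(kernelMeasure μ m n))) := by
    refine tendsto_lintegral_of_dominated_convergence (fun K => ‖w K‖ₑ ^ 2)
      (fun j => ((hw.indicator (hm j)).enorm).pow_const 2) (fun j => ae_of_all _ fun K => ?_) hfin ?_
    · exact pow_le_pow_left' (enorm_indicator_le_enorm_self _ _) 2
    · filter_upwards [hae] with K hK
      refine tendsto_const_nhds.congr' ?_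
      filter_upwards [hK] with j hj
      rw [Set.indicator_of_notMem hj, enorm_zero, zero_pow two_ne_zero]
  rw [lintegral_zero] at hlim
  have hpow := (ENNReal.continuous_rpow_const (y := 1 / 2)).tendsto (0 : ℝ≥0∞) |>.comp hlim
  rw [ENNReal.zero_rpow_of_pos (by norm_num)] at hpow
  have hreal := (ENNReal.tendsto_toReal ENNReal.zero_ne_top).comp hpow
  refine hreal.congr fun j => ?_
  rw [eLpNorm_eq_lintegral_rpow_enorm_toReal (by simp) (by simp)]
  simp

/-! ### Recovering the diagonal part -/

/-- One-photon states concentrating at a momentum of modulus `r` recover `w_{0,0}(r)` from `H(w)`: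
the diagonal part tends to `w_{0,0}(r)` and the interaction terms tend to zero. -/
lemma exists_tendsto_inner_H (r : I01) :
    ∃ φ : ℕ → Hred, (∀ j, ‖φ j‖ = 1) ∧
      ∀ {μ : ℝ≥0} {ξ : ℝ}, 0 < ξ → ξ ≤ 1 → ∀ w : KernelSeq μ ξ,
        Tendsto (fun j => ⟪φ j, w.H (φ j)⟫_ℂ) atTop (𝓝 (w.w00.fn r)) := by
  obtain ⟨k₀, hk₀⟩ := exists_norm_eq (EuclideanSpace ℝ (Fin 3)) r.2.1
  have hk₀1 : ‖k₀‖ ≤ 1 := hk₀.trans_le r.2.2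
  choose φ hφ1 hφ using fun j => exists_localized_state (isOpen_momentumNhd k₀ j)
    (momentumNhd_nonempty hk₀1 j) Set.inter_subset_right
  refine ⟨φ, hφ1, fun {μ ξ} hξ hξ1 w => ?_⟩
  have hdiag : Tendsto (fun j => ⟪φ j, w.H00 (φ j)⟫_ℂ) atTop (𝓝 (w.w00.fn r)) := by
    rw [Metric.tendsto_atTop]
    intro ε hε
    obtain ⟨δ, hδ, hcont⟩ := Metric.continuous_iff.1 w.w00.fn.continuous r (ε / 2) (half_pos hε)
    obtain ⟨N, hN⟩ := exists_nat_one_div_lt hδ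
    refine ⟨N, fun j hj => ?_⟩
    have hjδ : 1 / ((j : ℝ) + 1) < δ :=
      (one_div_le_one_div_of_le (by positivity) (by gcongr)).trans_lt hN
    rw [dist_eq_norm]
    refine (norm_inner_fnHf_sub_le (ε := ε / 2) (hφ1 j) ?_).trans_lt (half_lt_self hε)
    filter_upwards [hφ j] with x hx h0
    obtain ⟨hx1, hxU⟩ := hx h0
    obtain ⟨n, K⟩ := x
    obtain rfl : n = 1 := hx1
    rw [← dist_eq_norm]
    refine (hcont _ ?_).le
    have he : energy ⟨1, K⟩ = ‖(K 0).1‖ := by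
      change ∑ i : Fin 1, ‖(K i).1‖ = _
      rw [Fin.sum_univ_one]
    have hproj : r = Set.projIcc (0 : ℝ) 1 zero_le_one ‖k₀‖ := by
      rw [hk₀, Set.projIcc_val]
    rw [energy01, he, hproj]
    have hlip := (LipschitzWith.projIcc (zero_le_one' ℝ)).dist_le_mul ‖(K 0).1‖ ‖k₀‖
    rw [NNReal.coe_one, one_mul] at hlip
    refine hlip.trans_lt (lt_trans ?_ hjδ)
    exact (dist_norm_norm_le _ _).trans_lt (by
      rw [← dist_eq_norm]; exact Metric.mem_ball.1 (hxU 0).1)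
  have hoff : Tendsto (fun j => ∑' p, ⟪φ j, Hmn (w.off p) (φ j)⟫_ℂ) atTop (𝓝 0) := by
    suffices h : Tendsto (fun j => ∑' p, ⟪φ j, Hmn (w.off p) (φ j)⟫_ℂ) atTop
        (𝓝 (∑' _ : {p : ℕ × ℕ // p ≠ 0}, (0 : ℂ))) by
      rwa [tsum_zero] at h
    refine tendsto_tsum_of_dominated_convergence w.summable_off (fun p => ?_)
      (Eventually.of_forall fun j p => ?_)
    · refine squeeze_zero_norm (fun j => ?_) (tendsto_eLpNorm_localized p.2 (w.off p).toLp k₀)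
      refine norm_inner_Hmn_le (w.off p) (isOpen_momentumNhd k₀ j).measurableSet (hφ1 j) ?_
      filter_upwards [hφ j] with x hx h0
      exact (hx h0).2
    · calc ‖⟪φ j, Hmn (w.off p) (φ j)⟫_ℂ‖ ≤ ‖Hmn (w.off p)‖ := by
            refine (norm_inner_le_norm _ _).trans ?_
            rw [hφ1, one_mul]
            exact (Hmn (w.off p)).unit_le_opNorm _ (hφ1 j).le
        _ ≤ ‖(w.off p).toLp‖ := norm_Hmn_le _
        _ ≤ _ := le_mul_of_one_le_left (norm_nonneg _)
            ((one_le_inv₀ (pow_pos hξ _)).2 (pow_le_one₀ hξ.le hξ1))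
  have hsum : ∀ j, ⟪φ j, w.H (φ j)⟫_ℂ =
      ⟪φ j, w.H00 (φ j)⟫_ℂ + ∑' p, ⟪φ j, Hmn (w.off p) (φ j)⟫_ℂ := by
    intro j
    have h := (w.summable_Hmn hξ hξ1).hasSum
    have h1 := (h.mapL (ContinuousLinearMap.apply ℂ Hred (φ j))).mapL (innerSL ℂ (φ j))
    rw [KernelSeq.H]
    change ⟪φ j, w.H00 (φ j) + (∑' p, Hmn (w.off p)) (φ j)⟫_ℂ = _
    rw [inner_add_right]
    exact congrArg _ h1.tsum_eq.symm
  simp_rw [hsum]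
  simpa using hdiag.add hoff

/-- A linear combination of the functions `w_{0,0}` is bounded in supremum norm by the operator norm
of the same linear combination of the operators `H(w)`; here for a difference of two difference
quotients. -/
lemma norm_slope_w00_sub_le {μ : ℝ≥0} {ξ : ℝ} (hξ : 0 < ξ) (hξ1 : ξ ≤ 1)
    (w : ℂ → KernelSeq μ ξ) (a z z' : ℂ) :
    ‖slope (fun z => (w z).w00.fn) a z - slope (fun z => (w z).w00.fn) a z'‖ ≤
      ‖slope (fun z => (w z).H) a z - slope (fun z => (w z).H) a z'‖ := by
  rw [ContinuousMap.norm_le _ (norm_nonneg _)]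
  intro r
  obtain ⟨φ, hφ1, hφ⟩ := exists_tendsto_inner_H r
  have h : ∀ y, Tendsto (fun j => ⟪φ j, (w y).H (φ j)⟫_ℂ) atTop (𝓝 ((w y).w00.fn r)) :=
    fun y => hφ hξ hξ1 (w y)
  have hlim := (((h z).sub (h a)).const_smul (z - a)⁻¹).sub
    (((h z').sub (h a)).const_smul (z' - a)⁻¹)
  refine le_of_tendsto hlim.norm (Eventually.of_forall fun j => ?_)
  set T := slope (fun z => (w z).H) a z - slope (fun z => (w z).H) a z' with hT
  have hTj : ⟪φ j, T (φ j)⟫_ℂ =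
      (z - a)⁻¹ • (⟪φ j, (w z).H (φ j)⟫_ℂ - ⟪φ j, (w a).H (φ j)⟫_ℂ) -
        (z' - a)⁻¹ • (⟪φ j, (w z').H (φ j)⟫_ℂ - ⟪φ j, (w a).H (φ j)⟫_ℂ) := by
    change ⟪φ j, (z - a)⁻¹ • ((w z).H (φ j) - (w a).H (φ j)) -
      (z' - a)⁻¹ • ((w z').H (φ j) - (w a).H (φ j))⟫_ℂ = _
    simp only [inner_sub_right, inner_smul_right, smul_eq_mul]
  rw [← hTj]
  refine (norm_inner_le_norm _ _).trans ?_
  rw [hφ1, one_mul]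
  exact T.unit_le_opNorm _ (hφ1 j).le

lemma analyticAt_H00 {μ : ℝ≥0} {ξ : ℝ} (hξ : 0 < ξ) (hξ1 : ξ ≤ 1) {w : ℂ → KernelSeq μ ξ}
    {z₀ : ℂ} (h : AnalyticAt ℂ (fun z => (w z).H) z₀) :
    AnalyticAt ℂ (fun z => (w z).H00) z₀ :=
  (fnHfL.analyticAt _).comp
    (analyticAt_of_norm_slope_sub_le h fun a z z' => norm_slope_w00_sub_le hξ hξ1 w a z z')

end Renorm

theorem mainTheorem8 {ν : ℕ} {μ : ℝ≥0} {ξ : ℝ} (hμ : 0 < μ) (hξ : 0 < ξ) (hξ1 : ξ < 1)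
    (α : ℝ≥0∞) (β γ : ℝ) (S : Set (Fin (ν + 1) → ℂ)) (hS : IsOpen S)
    (w : (Fin (ν + 1) → ℂ) → Renorm.KernelSeq μ ξ)
    (hH : Renorm.AnalyticInEachVariable (fun σ => (w σ).H) S)
    (hB : ∀ σ ∈ S, (w σ).H ∈ Renorm.polydisc μ ξ α β γ) :
    Renorm.AnalyticInEachVariable (fun σ => (w σ).H00) S ∧
    ∀ (c : Renorm.Cutoff) (ρ : ℝ) (h0 : 0 < ρ),
      (∀ σ ∈ S, Renorm.FeshbachPair (c.op ρ) (c.opBar ρ) (w σ).H (w σ).H00) →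
      Renorm.AnalyticInEachVariable
        (fun σ => Renorm.feshbachMap (c.op ρ) (c.opBar ρ) (w σ).H (w σ).H00) S ∧
      ∀ h1 : ρ < 1, Renorm.AnalyticInEachVariable
        (fun σ => Renorm.renormalize c ρ h0 h1 (w σ).H (w σ).H00) S := by
  have hT : Renorm.AnalyticInEachVariable (fun σ => (w σ).H00) S := fun σ hσ j =>
    Renorm.analyticAt_H00 hξ hξ1.le (hH σ hσ j)
  refine ⟨hT, fun c ρ h0 hF => ?_⟩
  have hFan : Renorm.AnalyticInEachVariable
      (fun σ => Renorm.feshbachMap (c.op ρ) (c.opBar ρ) (w σ).H (w σ).H00) S := by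
    intro σ hσ j
    have hnear : ∀ᶠ z in 𝓝 (σ j), Function.update σ j z ∈ S := by
      refine (continuous_const.update j continuous_id).continuousAt.eventually_mem
        (hS.mem_nhds ?_)
      rwa [id, Function.update_eq_self]
    exact Renorm.analyticAt_feshbachMap (hH σ hσ j) (hT σ hσ j)
      (hnear.mono fun z hz => hF _ hz)
  refine ⟨hFan, fun h1 σ hσ j => ?_⟩
  have hcomp : ∀ {f : ℂ → Renorm.Hred →L[ℂ] Renorm.Hred} {z₀ : ℂ} (a : ℂ)
      (A B : Renorm.Hred →L[ℂ] Renorm.Hred), AnalyticAt ℂ f z₀ →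
      AnalyticAt ℂ (fun z => a • (A * (f z * B))) z₀ := fun a A B hf => by fun_prop
  exact hcomp _ _ _ (hFan σ hσ j)
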